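/- Let $H$ be a real Hilbert space and $A:\mathcal D(A)\to H$ a densely defined, self-adjoint, coercive operator. Let $V=\mathcal D(A^{1/2})$ with norm $\|v\|_V=\|A^{1/2}v\|_H$, identify $H\equiv H'\hookrightarrow V'$, regard $A$ also as an operator $V\to V'$ by $\langle Av,w\rangle_{V',V}=\langle A^{1/2}v,A^{1/2}w\rangle_H$, and let $\lambda_1>0$ satisfy $\lambda_1\|v\|_H^2\le\|v\|_V^2$ for all $v\in V$. Let $f:V\to H$ be Lipschitz continuous on bounded subsets of $V$, with potential $\mathcal F:V\to\mathbb R$, that is, $\mathcal F(0)=0$ and $\mathcal F'(u)(v)=\langle f(u),v\rangle_H$ for all $u,v\in V$, and suppose that for all $u\in V$ $$\langle f(u),u\rangle_H\le 0,\qquad \langle f(u),u\rangle_H-\mathcal F(u)\le 0 .$$ Let $\tau>0$, let $0=t_0<t_1<t_2<\cdots$, and put $I_n=[t_n,t_{n+1})$, $T_n=t_{n+1}-t_n$; assume $\tau\le T_{2n}$ for all $n\ge 0$. Let $U_2$ be a real Hilbert space, and let $B_1(t)\in\mathcal L(H)$ and $B_2(t)\in\mathcal L(U_2,H)$ satisfy,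 for every $n\ge 0$: $B_2(t)=0$ for $t\in I_{2n}$; $B_1(t)=0$ for $t\in I_{2n+1}$; $B_1$ on $I_{2n}$ and $B_2$ on $I_{2n+1}$ extend to $C^1$ functions on the closed intervals $[t_{2n},t_{2n+1}]$ and $[t_{2n+1},t_{2n+2}]$; and there are constants $0<m_{2n}\le M_{2n}$ and $M_{2n+1}>0$ such that for all $x\in H$ i) $m_{2n}\|x\|_H^2\le\|B_1^*(t)x\|_H^2\le M_{2n}\|x\|_H^2$ for $t\in I_{2n}$, ii) $\|B_2^*(t)x\|_{U_2}^2\le M_{2n+1}\|x\|_H^2$ for $t\in I_{2n+1}$. For $u_0\in V$, $u_1\in H$, consider the problem $$u_{tt}(t)+Au(t)+B_1(t)B_1^*(t)u_t(t)+B_2(t)B_2^*(t)u_t(t-\tau)=f(u(t)),\quad t>0,\qquad u(0)=u_0,\ u_t(0)=u_1. \tag{P}$$ A solution of (P) is a function $u$ such that, for every $T>0$, $u\in L^2(0,T;V)\cap H^1(0,T;H)\cap H^2(0,T;V')$, $\|B_1^*u_t\|_H$ and $\|B_2^*u_t(\cdot-\tau)\|_{U_2}$ belong to $L^2(0,T)$,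 $Au$, $B_1B_1^*u_t$ and $B_2B_2^*u_t(\cdot-\tau)$ belong to $L^2(0,T;V')$, $f(u)\in L^2(0,T;H)$, $u(0)=u_0$, $u_t(0)=u_1$, and the equation holds in $L^2(0,T;V')$. (Since $B_2=0$ on $[0,t_1)\supseteq[0,\tau)$, no values of $u_t$ at negative times are needed.) Set $$\tilde c_n=\frac{1}{1+\dfrac{T_{2n}^3}{30}\,\dfrac{1}{\frac{4}{\lambda_1m_{2n}}+\frac{3T_{2n}^2}{32\,m_{2n}}+\frac{M_{2n}T_{2n}^2}{16\lambda_1}}}+M_{2n+1}T_{2n+1}.$$ If $$\sum_{n=0}^{\infty}\bigl(2M_{2n+1}T_{2n+1}+\ln\tilde c_n\bigr)=-\infty$$ (the partial sums tend to $-\infty$), then for all $u_0\in V$, $u_1\in H$, every solution $u$ of (P) has a representative in $C([0,\infty);V)\cap C^1([0,\infty);H)$, and along this representative the standard energy $$E_S(t)=\tfrac12\bigl(\|u(t)\|_V^2+\|u_t(t)\|_H^2\bigr)-\mathcal F(u(t))$$ tends to $0$ as $t\to+\infty$. -/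

import Mathlib

open MeasureTheory Set Filter Topology
open scoped ContDiff

noncomputable section

namespace DelayWave

/-! ### The operator `A`, its square root and the space `V = D(A^{1/2})` -/

/-- A densely defined self-adjoint coercive operator `A : D(A) → H` on a real Hilbert space,
together with its square root `A^{1/2}`, i.e. the (unique) nonnegative self-adjoint operator
whose square is `A`. -/
structure CoerciveOperator (H : Type*) [NormedAddCommGroup H] [InnerProductSpace ℝ H]
    [CompleteSpace H] where
  /-- the operator `A` with its domain -/
  op : H →ₗ.[ℝ] H
  dense_domain : Dense (op.domain : Set H)
  selfAdjoint : IsSelfAdjoint op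
  coercive : ∃ c : ℝ, 0 < c ∧ ∀ x : op.domain, c * ‖(x : H)‖ ^ 2 ≤ inner ℝ (op x) (x : H)
  /-- the operator `A^{1/2}` with its domain -/
  sqrt : H →ₗ.[ℝ] H
  sqrt_selfAdjoint : IsSelfAdjoint sqrt
  sqrt_nonneg : ∀ x : sqrt.domain, 0 ≤ inner ℝ (sqrt x) (x : H)
  /-- `D(A) = {x ∈ D(A^{1/2}) : A^{1/2} x ∈ D(A^{1/2})}` -/
  mem_domain_iff : ∀ x : H, x ∈ op.domain ↔ ∃ hx : x ∈ sqrt.domain, sqrt ⟨x, hx⟩ ∈ sqrt.domain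
  /-- `A x = A^{1/2} (A^{1/2} x)` on `D(A)` -/
  op_eq : ∀ (x : op.domain) (hx : (x : H) ∈ sqrt.domain) (hSx : sqrt ⟨x, hx⟩ ∈ sqrt.domain),
    op x = sqrt ⟨sqrt ⟨x, hx⟩, hSx⟩

section EnergySpace

variable {H : Type*} [NormedAddCommGroup H] [InnerProductSpace ℝ H] [CompleteSpace H]

theorem inner_sqrt_left (𝒜 : CoerciveOperator H) (x y : 𝒜.sqrt.domain) :
    inner ℝ (𝒜.sqrt x) (y : H) = inner ℝ (x : H) (𝒜.sqrt y) := by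
  have h := LinearPMap.adjoint_isFormalAdjoint (T := 𝒜.sqrt) 𝒜.sqrt_selfAdjoint.dense_domain
  rw [LinearPMap.isSelfAdjoint_def.mp 𝒜.sqrt_selfAdjoint] at h
  exact h x y

theorem dense_range_op (𝒜 : CoerciveOperator H) :
    Dense (LinearMap.range 𝒜.op.toFun : Set H) := by
  rw [Submodule.dense_iff_topologicalClosure_eq_top, Submodule.topologicalClosure_eq_top_iff,
    Submodule.eq_bot_iff]
  intro y hy
  have hy' : ∀ x : 𝒜.op.domain, inner ℝ (0 : H) (x : H) = inner ℝ y (𝒜.op x) := by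
    intro x
    have := (Submodule.mem_orthogonal' _ _).mp hy (𝒜.op x) ⟨x, rfl⟩
    rw [this, inner_zero_left]
  have hmem := LinearPMap.mem_adjoint_domain_of_exists (T := 𝒜.op) y ⟨0, hy'⟩
  have hval := LinearPMap.adjoint_apply_eq 𝒜.dense_domain ⟨y, hmem⟩ hy'
  have key : ∀ T : H →ₗ.[ℝ] H, T = 𝒜.op → ∀ h : y ∈ T.domain, T ⟨y, h⟩ = 0 → y = 0 := by
    rintro T rfl h h0
    obtain ⟨c, hc, hco⟩ := 𝒜.coercive
    have := hco ⟨y, h⟩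
    rw [h0, inner_zero_left] at this
    have h2 : ‖y‖ ^ 2 ≤ 0 := by
      by_contra hlt
      push Not at hlt
      exact absurd this (not_le.mpr (mul_pos hc hlt))
    have h3 : ‖y‖ = 0 := by nlinarith [norm_nonneg y]
    exact norm_eq_zero.mp h3
  exact key _ (LinearPMap.isSelfAdjoint_def.mp 𝒜.selfAdjoint) hmem hval

/-- Coercivity of `A` passes to `A^{1/2}` : `‖x‖ ≤ K ‖A^{1/2} x‖` on `D(A^{1/2})`. -/
theorem exists_norm_le_sqrt (𝒜 : CoerciveOperator H) :
    ∃ K : ℝ, ∀ x : 𝒜.sqrt.domain, ‖(x : H)‖ ≤ K * ‖𝒜.sqrt x‖ := by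
  obtain ⟨c, hc, hco⟩ := 𝒜.coercive
  have hsc : 0 < √c := Real.sqrt_pos.mpr hc
  refine ⟨(√c)⁻¹, fun x => ?_⟩
  have h1 : ∀ y : H, √c * inner ℝ (x : H) y ≤ ‖𝒜.sqrt x‖ * ‖y‖ := by
    have hcl : IsClosed {y : H | √c * inner ℝ (x : H) y ≤ ‖𝒜.sqrt x‖ * ‖y‖} :=
      isClosed_le (by fun_prop) (by fun_prop)
    have hsub : (LinearMap.range 𝒜.op.toFun : Set H) ⊆
        {y : H | √c * inner ℝ (x : H) y ≤ ‖𝒜.sqrt x‖ * ‖y‖} := by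
      rintro _ ⟨z, rfl⟩
      obtain ⟨hz, hSz⟩ := (𝒜.mem_domain_iff z).mp z.2
      have hAz : 𝒜.op z = 𝒜.sqrt ⟨𝒜.sqrt ⟨z, hz⟩, hSz⟩ := 𝒜.op_eq z hz hSz
      have e1 : inner ℝ (x : H) (𝒜.op z) = inner ℝ (𝒜.sqrt x) (𝒜.sqrt ⟨z, hz⟩) := by
        rw [hAz, ← inner_sqrt_left]
      have e2 : inner ℝ (𝒜.op z) (z : H) = ‖𝒜.sqrt ⟨z, hz⟩‖ ^ 2 := by
        rw [hAz, inner_sqrt_left 𝒜 ⟨_, hSz⟩ ⟨z, hz⟩, real_inner_self_eq_norm_sq]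
      have e3 := real_inner_le_norm (𝒜.op z) (z : H)
      have e4 := hco z
      have e5 := real_inner_le_norm (𝒜.sqrt x) (𝒜.sqrt ⟨z, hz⟩)
      set a := ‖𝒜.op z‖
      set b := ‖(z : H)‖
      set s := ‖𝒜.sqrt ⟨(z : H), hz⟩‖
      have ha : 0 ≤ a := norm_nonneg _
      have hb : 0 ≤ b := norm_nonneg _
      have hs : 0 ≤ s := norm_nonneg _
      have hcs : √c ^ 2 = c := Real.sq_sqrt hc.le
      have hcb : c * b ≤ a := by
        rcases hb.eq_or_lt with h0 | h0
        · rw [← h0]; simpa using ha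
        · have : c * b * b ≤ a * b := by nlinarith
          exact le_of_mul_le_mul_right this h0
      have hsa : √c * s ≤ a := by
        apply le_of_sq_le_sq _ ha
        calc (√c * s) ^ 2 = c * s ^ 2 := by rw [mul_pow, hcs]
          _ ≤ c * (a * b) := by gcongr; linarith
          _ = a * (c * b) := by ring
          _ ≤ a * a := by gcongr
          _ = a ^ 2 := by ring
      change √c * inner ℝ (x : H) (𝒜.op z) ≤ ‖𝒜.sqrt x‖ * a
      rw [e1]
      calc √c * inner ℝ (𝒜.sqrt x) (𝒜.sqrt ⟨z, hz⟩) ≤ √c * (‖𝒜.sqrt x‖ * s) := by gcongr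
        _ = ‖𝒜.sqrt x‖ * (√c * s) := by ring
        _ ≤ ‖𝒜.sqrt x‖ * a := by gcongr
    intro y
    have := hcl.closure_subset_iff.mpr hsub
    exact this ((dense_range_op 𝒜) y)
  have h2 := h1 x
  rw [real_inner_self_eq_norm_sq] at h2
  rw [inv_mul_eq_div, le_div_iff₀ hsc]
  rcases (norm_nonneg (x : H)).eq_or_lt with h0 | h0
  · rw [← h0]; simp
  · have : ‖(x : H)‖ * √c * ‖(x : H)‖ ≤ ‖𝒜.sqrt x‖ * ‖(x : H)‖ := by nlinarith
    exact le_of_mul_le_mul_right this h0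

/-- The space `V = D(A^{1/2})`, with inner product `⟨A^{1/2} v, A^{1/2} w⟩_H` and hence norm
`‖v‖_V = ‖A^{1/2} v‖_H`. -/
def CoerciveOperator.V (𝒜 : CoerciveOperator H) : Type _ := 𝒜.sqrt.domain

instance (𝒜 : CoerciveOperator H) : AddCommGroup 𝒜.V :=
  inferInstanceAs (AddCommGroup 𝒜.sqrt.domain)

instance (𝒜 : CoerciveOperator H) : Module ℝ 𝒜.V :=
  inferInstanceAs (Module ℝ 𝒜.sqrt.domain)

/-- `A^{1/2} : V → H`. -/
def sqrtMap (𝒜 : CoerciveOperator H) : 𝒜.V →ₗ[ℝ] H := 𝒜.sqrt.toFun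

/-- The inner product `⟨v, w⟩_V = ⟨A^{1/2} v, A^{1/2} w⟩_H`. -/
@[reducible]
def energyCore (𝒜 : CoerciveOperator H) : InnerProductSpace.Core ℝ 𝒜.V where
  inner v w := inner ℝ (sqrtMap 𝒜 v) (sqrtMap 𝒜 w)
  conj_inner_symm v w := by simp [real_inner_comm]
  re_inner_nonneg v := by simp
  add_left u v w := by simp [inner_add_left]
  smul_left v w r := by simp [real_inner_smul_left]
  definite v hv := by
    obtain ⟨K, hK⟩ := exists_norm_le_sqrt 𝒜
    have h0 : 𝒜.sqrt v = 0 := inner_self_eq_zero.mp hv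
    have h1 := hK v
    rw [h0, norm_zero, mul_zero] at h1
    exact Subtype.ext (norm_eq_zero.mp (le_antisymm h1 (norm_nonneg _)))

instance (𝒜 : CoerciveOperator H) : NormedAddCommGroup 𝒜.V :=
  (energyCore 𝒜).toNormedAddCommGroup

instance (𝒜 : CoerciveOperator H) : InnerProductSpace ℝ 𝒜.V :=
  InnerProductSpace.ofCore (energyCore 𝒜).toCore

theorem inner_V (𝒜 : CoerciveOperator H) (v w : 𝒜.V) :
    inner ℝ v w = inner ℝ (sqrtMap 𝒜 v) (sqrtMap 𝒜 w) := rfl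

theorem norm_V (𝒜 : CoerciveOperator H) (v : 𝒜.V) : ‖v‖ = ‖sqrtMap 𝒜 v‖ := by
  have h : ‖v‖ ^ 2 = ‖sqrtMap 𝒜 v‖ ^ 2 := by
    rw [← real_inner_self_eq_norm_sq, ← real_inner_self_eq_norm_sq, inner_V]
  exact (sq_eq_sq₀ (norm_nonneg _) (norm_nonneg _)).mp h

/-- The inclusion `V → H` as a linear map. -/
def inclₗ (𝒜 : CoerciveOperator H) : 𝒜.V →ₗ[ℝ] H := 𝒜.sqrt.domain.subtype

theorem exists_norm_incl_le (𝒜 : CoerciveOperator H) :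
    ∃ K : ℝ, ∀ v : 𝒜.V, ‖inclₗ 𝒜 v‖ ≤ K * ‖v‖ := by
  obtain ⟨K, hK⟩ := exists_norm_le_sqrt 𝒜
  exact ⟨K, fun v => by rw [norm_V]; exact hK v⟩

/-- The embedding `V ↪ H`. -/
def incl (𝒜 : CoerciveOperator H) : 𝒜.V →L[ℝ] H :=
  (inclₗ 𝒜).mkContinuousOfExistsBound (exists_norm_incl_le 𝒜)

/-- The embedding `H ≡ H' ↪ V'`, `h ↦ ⟨h, ·⟩_H`. -/
def toDualV (𝒜 : CoerciveOperator H) (h : H) : StrongDual ℝ 𝒜.V :=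
  (innerSL ℝ h).comp (incl 𝒜)

/-- `A` extended to an operator `V → V'`, `⟨A v, w⟩_{V',V} = ⟨A^{1/2} v, A^{1/2} w⟩_H`. -/
def opExt (𝒜 : CoerciveOperator H) (v : 𝒜.V) : StrongDual ℝ 𝒜.V := innerSL ℝ v

/-- On `D(A)` the extension agrees with `A`. -/
theorem opExt_eq_toDualV (𝒜 : CoerciveOperator H) (v : 𝒜.V) (hv : incl 𝒜 v ∈ 𝒜.op.domain) :
    opExt 𝒜 v = toDualV 𝒜 (𝒜.op ⟨incl 𝒜 v, hv⟩) := by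
  ext w
  obtain ⟨hz, hSz⟩ := (𝒜.mem_domain_iff _).mp hv
  change inner ℝ (𝒜.sqrt v) (𝒜.sqrt w) = inner ℝ (𝒜.op ⟨incl 𝒜 v, hv⟩) (Subtype.val w)
  rw [𝒜.op_eq ⟨incl 𝒜 v, hv⟩ hz hSz, inner_sqrt_left 𝒜 ⟨_, hSz⟩ w]
  rfl

end EnergySpace

/-! ### Solutions of the delayed problem -/

/-- `g ∈ H¹(0,T;X)` with derivative `g'` and initial value `x₀`: both `g` and `g'` belong to
`L²(0,T;X)` and `g(t) = x₀ + ∫₀ᵗ g'(s) ds` for almost every `t ∈ (0,T)`; the right-hand side is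
the continuous representative of `g`. -/
structure MemH1 {X : Type*} [NormedAddCommGroup X] [NormedSpace ℝ X]
    (T : ℝ) (x₀ : X) (g g' : ℝ → X) : Prop where
  memLp : MemLp g 2 (volume.restrict (Ioo 0 T))
  memLp_deriv : MemLp g' 2 (volume.restrict (Ioo 0 T))
  eq_primitive : ∀ᵐ t ∂volume.restrict (Ioo 0 T), g t = x₀ + ∫ s in (0 : ℝ)..t, g' s

/-- `u`, with time derivative `ut`, is a solution of
`u_tt(t) + A u(t) + B₁(t) B₁*(t) u_t(t) + B₂(t) B₂*(t) u_t(t - τ) = f(u(t))`, `t > 0`,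
with `u(0) = u₀ ∈ V` and `u_t(0) = u₁ ∈ H`: on every interval `(0,T)`,
`u ∈ L²(V) ∩ H¹(H) ∩ H²(V')`, the listed terms are square integrable, and the equation holds in
`L²(0,T;V')`. -/
def IsSolution {H U₁ U₂ : Type*}
    [NormedAddCommGroup H] [InnerProductSpace ℝ H] [CompleteSpace H]
    [NormedAddCommGroup U₁] [InnerProductSpace ℝ U₁] [CompleteSpace U₁]
    [NormedAddCommGroup U₂] [InnerProductSpace ℝ U₂] [CompleteSpace U₂]
    (𝒜 : CoerciveOperator H) (f : 𝒜.V → H) (B₁ : ℝ → U₁ →L[ℝ] H) (B₂ : ℝ → U₂ →L[ℝ] H)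
    (τ : ℝ) (u₀ : 𝒜.V) (u₁ : H) (u : ℝ → 𝒜.V) (ut : ℝ → H) : Prop :=
  ∃ utt : ℝ → StrongDual ℝ 𝒜.V, ∀ T : ℝ, 0 < T →
    MemLp u 2 (volume.restrict (Ioo 0 T)) ∧
    MemH1 T (incl 𝒜 u₀) (fun t => incl 𝒜 (u t)) ut ∧
    MemH1 T (toDualV 𝒜 u₁) (fun t => toDualV 𝒜 (ut t)) utt ∧
    MemLp (fun t => ‖(B₁ t).adjoint (ut t)‖) 2 (volume.restrict (Ioo 0 T)) ∧
    MemLp (fun t => ‖(B₂ t).adjoint (ut (t - τ))‖) 2 (volume.restrict (Ioo 0 T)) ∧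
    MemLp (fun t => opExt 𝒜 (u t)) 2 (volume.restrict (Ioo 0 T)) ∧
    MemLp (fun t => toDualV 𝒜 (B₁ t ((B₁ t).adjoint (ut t)))) 2 (volume.restrict (Ioo 0 T)) ∧
    MemLp (fun t => toDualV 𝒜 (B₂ t ((B₂ t).adjoint (ut (t - τ))))) 2
      (volume.restrict (Ioo 0 T)) ∧
    MemLp (fun t => f (u t)) 2 (volume.restrict (Ioo 0 T)) ∧
    ∀ᵐ t ∂volume.restrict (Ioo 0 T),
      utt t + opExt 𝒜 (u t) + toDualV 𝒜 (B₁ t ((B₁ t).adjoint (ut t)))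
        + toDualV 𝒜 (B₂ t ((B₂ t).adjoint (ut (t - τ)))) = toDualV 𝒜 (f (u t))

/-- The standard energy `½ (‖u‖_V² + ‖u_t‖_H²) - 𝓕(u)`. -/
def energyS {H : Type*} [NormedAddCommGroup H] [InnerProductSpace ℝ H] [CompleteSpace H]
    {𝒜 : CoerciveOperator H} (F : 𝒜.V → ℝ) (v : 𝒜.V) (w : H) : ℝ :=
  (1 / 2) * (‖v‖ ^ 2 + ‖w‖ ^ 2) - F v

/-! ### Assumptions on the nonlinearity and on the feedback operators -/

/-- `f : V → H` is Lipschitz continuous on bounded subsets of `V`. -/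
def LocLipschitz {V H : Type*} [NormedAddCommGroup V] [NormedAddCommGroup H] (f : V → H) : Prop :=
  ∀ K : ℝ, 0 < K → ∃ L : ℝ, ∀ u v : V, ‖u‖ ≤ K → ‖v‖ ≤ K → ‖f u - f v‖ ≤ L * ‖u - v‖

/-- `𝓕` is the potential of `f` : `𝓕(0) = 0` and `𝓕'(u)(v) = ⟨f(u), v⟩`. -/
def IsPotential {H : Type*} [NormedAddCommGroup H] [InnerProductSpace ℝ H] [CompleteSpace H]
    {𝒜 : CoerciveOperator H} (F : 𝒜.V → ℝ) (f : 𝒜.V → H) : Prop :=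
  F 0 = 0 ∧ ∀ u : 𝒜.V, HasFDerivAt F (toDualV 𝒜 (f u)) u

/-- `B`, as a function on `[a,b)`, is of class `C¹` up to the closed interval `[a,b]`: on `[a,b)`
it coincides with a function of class `C¹` on `[a,b]`. The value of `B` at `b` is not involved. -/
def IsC1UpTo {X : Type*} [NormedAddCommGroup X] [NormedSpace ℝ X] (B : ℝ → X) (a b : ℝ) : Prop :=
  ∃ G : ℝ → X, ContDiffOn ℝ 1 G (Icc a b) ∧ EqOn B G (Ico a b)

/-- The length `T_n` of the interval `I_n = [t_n, t_{n+1})`. -/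
def len (t : ℕ → ℝ) (n : ℕ) : ℝ := t (n + 1) - t n

/-- The factor `c̃_n`. -/
def cTilde (lam : ℝ) (m M : ℕ → ℝ) (t : ℕ → ℝ) (n : ℕ) : ℝ :=
  1 / (1 + len t (2 * n) ^ 3 / 30 *
      (1 / (4 / (lam * m (2 * n)) + 3 * len t (2 * n) ^ 2 / (32 * m (2 * n))
        + M (2 * n) * len t (2 * n) ^ 2 / (16 * lam))))
    + M (2 * n + 1) * len t (2 * n + 1)

end DelayWave

end

/-! The energy is followed over each pair `[t (2n), t (2n+2)]`. It is nonnegative because the first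
sign condition forces `F ≤ 0` along rays (`potential_nonpos`), and it dominates half of `‖u_t‖²`.

On an even interval there is only damping and `E' = -‖B₁* u_t‖²`. Pairing the equation with `φ u`,
where `φ = (s-a)²(b-s)²`, bounds `∫ φ E` by the total dissipation: the second sign condition absorbs
the nonlinearity, and the lower bound on `B₁*` controls `‖u_t‖`. Since `E` decreases, `∫ φ E ≥
(T⁵/30) E(b)`, which gives the contraction factor in `c̃_n` (`multiplier_estimate`,
`multiplier_decay`, `energy_decay`).

On an odd interval the delayed term contributes at most `M/2 (‖u_t(s-τ)‖² + ‖u_t(s)‖²)` to `E'`. The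
part of the delayed integral before the interval sees only the preceding even interval, as `τ ≤
T_{2n}`, and there `E ≤ E(t_{2n})`. Gronwall then gives the growth bound (`delayed_growth`,
`energy_growth`). The combined factor over a pair is `c̃_n exp(2 M T)`, with `M` and `T` those of
the odd interval; the divergence hypothesis says that the products of these factors tend to zero
(`tendsto_zero_of_interval_bounds`).

All this needs the energy identity, which is not available directly for a weak solution, since `u_t`
is only `H`-valued. With `j : V → H` the embedding, the Riesz isomorphism turns the equation in `V'`
into `(j† u_t)' + u = j† g`. Applying `R = (ε + j†j)⁻¹ j†` gives curves with an exact energy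
balance; the bound on them is linear in the data, so they are locally uniformly Cauchy as `ε → 0`.
The limit is the continuous representative and inherits the identity
(`IsWeakWave.exists_continuous`, `IsSolution.exists_regular`). -/

noncomputable section

namespace DelayWave

/-! ### Regularization of an injective embedding with dense range -/

section Regularizer

variable {V H : Type*} [NormedAddCommGroup V] [InnerProductSpace ℝ V] [CompleteSpace V]
  [NormedAddCommGroup H] [InnerProductSpace ℝ H] [CompleteSpace H]

/-- The resolvent `(ε + j† j)⁻¹`. -/
theorem exists_resolvent (j : V →L[ℝ] H) {ε : ℝ} (hε : 0 < ε) :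
    ∃ Q : V →L[ℝ] V, (∀ x, ε • Q x + j.adjoint (j (Q x)) = x) ∧
      ∀ x, Q (ε • x + j.adjoint (j x)) = x := by
  set S : V →L[ℝ] V := ε • ContinuousLinearMap.id ℝ V + j.adjoint ∘L j with hS
  -- Lax–Milgram: the form of `ε + j†j` dominates `ε ‖x‖²`, so the operator is invertible.
  have hco : IsCoercive ((innerSL ℝ).comp S : V →L[ℝ] V →L[ℝ] ℝ) := by
    refine ⟨ε, hε, fun x => ?_⟩
    have h1 : ((innerSL ℝ).comp S : V →L[ℝ] V →L[ℝ] ℝ) x x = ε * (‖x‖ * ‖x‖) + ‖j x‖ ^ 2 := by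
      rw [ContinuousLinearMap.comp_apply, innerSL_apply_apply]
      simp [hS, inner_add_left, real_inner_smul_left, ContinuousLinearMap.adjoint_inner_left,
        pow_two]
    rw [h1]
    nlinarith [sq_nonneg ‖j x‖]
  have hE : ∀ x, hco.continuousLinearEquivOfBilin x = ε • x + j.adjoint (j x) := by
    intro x
    refine ext_inner_right ℝ fun y => ?_
    rw [hco.continuousLinearEquivOfBilin_apply]
    rfl
  refine ⟨hco.continuousLinearEquivOfBilin.symm, fun x => ?_, fun x => ?_⟩
  · have := hE (hco.continuousLinearEquivOfBilin.symm x)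
    simpa using this.symm
  · rw [← hE x]
    simp

/-- Properties of the regularization `(ε + j† j)⁻¹ j†`. -/
theorem exists_regularization (j : V →L[ℝ] H) {ε : ℝ} (hε : 0 < ε) :
    ∃ R : H →L[ℝ] V, (∀ h k, inner ℝ (j (R h)) k = inner ℝ h (j (R k))) ∧
      (∀ x y, inner ℝ (R (j x)) y = inner ℝ x (R (j y))) ∧
      (∀ h, ‖j (R h)‖ ≤ ‖h‖) ∧ (∀ x, ‖R (j x)‖ ≤ ‖x‖) ∧
      ∀ h, ‖R (j (j.adjoint h)) - j.adjoint h‖ ≤ √ε * ‖h‖ := by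
  obtain ⟨Q, hQ1, hQ2⟩ := exists_resolvent j hε
  have hsymm : ∀ x y, inner ℝ (Q x) y = inner ℝ x (Q y) := by
    intro x y
    conv_lhs => rw [← hQ1 y]
    conv_rhs => rw [← hQ1 x]
    simp [inner_add_left, inner_add_right, real_inner_smul_left, real_inner_smul_right,
      ContinuousLinearMap.adjoint_inner_left, ContinuousLinearMap.adjoint_inner_right]
  have hcomm : ∀ x, Q (j.adjoint (j x)) = j.adjoint (j (Q x)) := by
    intro x
    have h1 := hQ1 x
    have h2 := hQ2 x
    rw [map_add, map_smul] at h2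
    have := h1.trans h2.symm
    exact (add_left_cancel this).symm
  -- Pairing `ε z + j†j z = j† h` with `z` yields both the contraction property and `ε ‖z‖² ≤ ‖h‖²`,
  -- which is the source of the rate `√ε`.
  have key : ∀ h, ε * ‖Q (j.adjoint h)‖ ^ 2 =
      inner ℝ (h - j (Q (j.adjoint h))) (j (Q (j.adjoint h))) := by
    intro h
    have h1 := hQ1 (j.adjoint h)
    set z := Q (j.adjoint h)
    have h2 : ε • z = j.adjoint (h - j z) := by
      rw [map_sub, ← h1]; simp
    rw [← ContinuousLinearMap.adjoint_inner_left, ← h2, real_inner_smul_left,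
      real_inner_self_eq_norm_sq]
  have hcontr : ∀ h, ‖j (Q (j.adjoint h))‖ ≤ ‖h‖ := by
    intro h
    have h1 := key h
    have h2 : 0 ≤ ε * ‖Q (j.adjoint h)‖ ^ 2 := by positivity
    rw [inner_sub_left, real_inner_self_eq_norm_sq] at h1
    have h3 := real_inner_le_norm h (j (Q (j.adjoint h)))
    by_contra hlt
    push Not at hlt
    nlinarith [norm_nonneg h, norm_nonneg (j (Q (j.adjoint h)))]
  refine ⟨Q ∘L j.adjoint, fun h k => ?_, fun x y => ?_, hcontr, fun x => ?_, fun h => ?_⟩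
  · simp only [ContinuousLinearMap.comp_apply]
    rw [← ContinuousLinearMap.adjoint_inner_right, hsymm, ContinuousLinearMap.adjoint_inner_left]
  · simp only [ContinuousLinearMap.comp_apply]
    rw [hsymm, hcomm y, ContinuousLinearMap.adjoint_inner_left,
      ContinuousLinearMap.adjoint_inner_right]
  · simp only [ContinuousLinearMap.comp_apply]
    set y := Q (j.adjoint (j x)) with hy
    have h1 : ε • y + j.adjoint (j y) = j.adjoint (j x) := hQ1 _
    have h2 : ε • y = j.adjoint (j (x - y)) := by
      rw [map_sub, map_sub, ← h1]; simp
    have h3 : ε * inner ℝ y (x - y) = ‖j (x - y)‖ ^ 2 := by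
      rw [← real_inner_smul_left, h2, ContinuousLinearMap.adjoint_inner_left,
        real_inner_self_eq_norm_sq]
    have h4 : 0 ≤ inner ℝ y (x - y) := by
      by_contra hlt
      push Not at hlt
      nlinarith [sq_nonneg ‖j (x - y)‖]
    rw [inner_sub_right, real_inner_self_eq_norm_sq] at h4
    have h5 := real_inner_le_norm y x
    by_contra hlt
    push Not at hlt
    nlinarith [norm_nonneg x, norm_nonneg y]
  · simp only [ContinuousLinearMap.comp_apply]
    have h1 := hQ1 (j.adjoint h)
    have h2 := key h
    have h0 := hcontr h
    rw [hcomm]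
    set z := Q (j.adjoint h)
    -- Since `Q` commutes with `j†j`, the error on the range of `j†` is exactly `-ε z`.
    have h3 : j.adjoint (j z) - j.adjoint h = -(ε • z) := by rw [← h1]; simp
    rw [h3, norm_neg, norm_smul, Real.norm_of_nonneg hε.le]
    have h4 : ε * ‖z‖ ^ 2 ≤ ‖h‖ ^ 2 := by
      rw [h2, inner_sub_left, real_inner_self_eq_norm_sq]
      have := real_inner_le_norm h (j z)
      nlinarith [norm_nonneg h, norm_nonneg (j z), sq_nonneg ‖j z‖]
    apply le_of_sq_le_sq _ (by positivity)
    calc (ε * ‖z‖) ^ 2 = ε * (ε * ‖z‖ ^ 2) := by ring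
      _ ≤ ε * ‖h‖ ^ 2 := by gcongr
      _ = (√ε * ‖h‖) ^ 2 := by rw [mul_pow, Real.sq_sqrt hε.le]

/-- Uniformly bounded linear operators converging to the identity on a dense set converge
strongly. -/
theorem tendsto_of_dense_of_norm_le {X : Type*} [NormedAddCommGroup X] [NormedSpace ℝ X]
    (J : ℕ → X →L[ℝ] X) (hJ : ∀ n x, ‖J n x‖ ≤ ‖x‖) {s : Set X} (hs : Dense s)
    (hlim : ∀ x ∈ s, Tendsto (fun n => J n x) atTop (𝓝 x)) (x : X) :
    Tendsto (fun n => J n x) atTop (𝓝 x) := by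
  rw [Metric.tendsto_atTop]
  intro ε hε
  obtain ⟨y, hy, hxy⟩ := Metric.mem_closure_iff.mp (hs x) (ε / 3) (by positivity)
  obtain ⟨N, hN⟩ := Metric.tendsto_atTop.mp (hlim y hy) (ε / 3) (by positivity)
  refine ⟨N, fun n hn => ?_⟩
  have h1 := hN n hn
  rw [dist_eq_norm] at *
  have h2 := hJ n (x - y)
  have h3 : J n x - x = J n (x - y) + (J n y - y) - (x - y) := by rw [map_sub]; abel
  rw [h3]
  calc _ ≤ ‖J n (x - y)‖ + ‖J n y - y‖ + ‖x - y‖ :=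
        (norm_sub_le _ _).trans (by gcongr; exact norm_add_le _ _)
    _ < ε := by linarith

/-- A sequence of regularizing operators `R n : H → V` such that `j ∘ R n` and `R n ∘ j` are
symmetric contractions converging strongly to the identity. -/
theorem exists_regularizing_sequence (j : V →L[ℝ] H) (hinj : Function.Injective j)
    (hdense : DenseRange j) :
    ∃ R : ℕ → H →L[ℝ] V, (∀ n h k, inner ℝ (j (R n h)) k = inner ℝ h (j (R n k))) ∧
      (∀ n x y, inner ℝ (R n (j x)) y = inner ℝ x (R n (j y))) ∧
      (∀ n h, ‖j (R n h)‖ ≤ ‖h‖) ∧ (∀ n x, ‖R n (j x)‖ ≤ ‖x‖) ∧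
      (∀ x, Tendsto (fun n => R n (j x)) atTop (𝓝 x)) ∧
      ∀ h, Tendsto (fun n => j (R n h)) atTop (𝓝 h) := by
  choose R h1 h2 h3 h4 h5 using
    fun n : ℕ => exists_regularization j (ε := 1 / ((n : ℝ) + 1)) (by positivity)
  -- The orthogonal complement of the range of `j†` is the kernel of `j`. Convergence is thus proved
  -- first on the range of `j†`, then on `V`, then on the range of `j`, then on `H`.
  have hadj : DenseRange j.adjoint := by
    have : Dense (LinearMap.range (j.adjoint : H →ₗ[ℝ] V) : Set V) := by
      rw [Submodule.dense_iff_topologicalClosure_eq_top, Submodule.topologicalClosure_eq_top_iff,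
        Submodule.eq_bot_iff]
      intro y hy
      have h : inner ℝ (j.adjoint (j y)) y = 0 :=
        (Submodule.mem_orthogonal _ _).mp hy _ ⟨j y, rfl⟩
      rw [ContinuousLinearMap.adjoint_inner_left, inner_self_eq_zero] at h
      exact hinj (by rw [h, map_zero])
    exact this
  have hV : ∀ x, Tendsto (fun n => R n (j x)) atTop (𝓝 x) := by
    refine tendsto_of_dense_of_norm_le (fun n => R n ∘L j) h4 hadj ?_
    rintro _ ⟨h, rfl⟩
    rw [tendsto_iff_norm_sub_tendsto_zero]
    have hlim : Tendsto (fun n : ℕ => √(1 / ((n : ℝ) + 1)) * ‖h‖) atTop (𝓝 0) := by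
      have := (Real.continuous_sqrt.tendsto 0).comp
        (tendsto_one_div_add_atTop_nhds_zero_nat (𝕜 := ℝ))
      simpa [Function.comp_def] using this.mul_const ‖h‖
    exact squeeze_zero (fun _ => norm_nonneg _) (fun n => h5 n h) hlim
  refine ⟨R, h1, h2, h3, h4, hV, ?_⟩
  refine tendsto_of_dense_of_norm_le (fun n => j ∘L R n) h3 hdense ?_
  rintro _ ⟨x, rfl⟩
  exact (j.continuous.tendsto x).comp (hV x)

end Regularizer

/-! ### Product rule for primitives of integrable functions -/

section Primitive

variable {X : Type*} [NormedAddCommGroup X] [InnerProductSpace ℝ X]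

theorem absolutelyContinuousOnInterval_of_dist_le {E F : Type*} [PseudoMetricSpace E]
    [PseudoMetricSpace F] {f : ℝ → E} {A : ℝ → F} {a b C : ℝ}
    (hA : AbsolutelyContinuousOnInterval A a b)
    (h : ∀ x ∈ uIcc a b, ∀ y ∈ uIcc a b, dist (f x) (f y) ≤ C * dist (A x) (A y)) :
    AbsolutelyContinuousOnInterval f a b := by
  unfold AbsolutelyContinuousOnInterval at *
  refine squeeze_zero' (Eventually.of_forall fun E => Finset.sum_nonneg fun i _ => dist_nonneg)
    ?_ (by simpa using hA.const_mul C)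
  refine (eventually_inf_principal.mpr (Eventually.of_forall ?_))
  rintro ⟨n, I⟩ hI
  rw [Finset.mul_sum]
  refine Finset.sum_le_sum fun i hi => ?_
  have := hI.1 i hi
  exact h _ this.1 _ this.2

theorem intervalIntegrable_inner_of_continuousOn {p q : ℝ → X} {a b : ℝ}
    (hp : ContinuousOn p (uIcc a b)) (hq : IntervalIntegrable q volume a b) :
    IntervalIntegrable (fun t => inner ℝ (p t) (q t)) volume a b := by
  obtain ⟨C, hC⟩ := isCompact_uIcc.exists_bound_of_continuousOn hp
  rw [intervalIntegrable_iff] at hq ⊢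
  refine Integrable.mono' (hq.norm.const_mul C) ?_ ?_
  · exact ((hp.mono uIoc_subset_uIcc).aestronglyMeasurable measurableSet_uIoc).inner hq.1
  · filter_upwards [ae_restrict_mem measurableSet_uIoc] with t ht
    exact (norm_inner_le_norm _ _).trans (by gcongr; exact hC t (uIoc_subset_uIcc ht))

/-- The product rule for `‖p‖²` when `p` is the primitive of an integrable function. -/
theorem norm_sq_add_primitive [CompleteSpace X] (p₀ : X) {a : ℝ → X} {T : ℝ}
    (ha : IntervalIntegrable a volume 0 T) :
    ‖p₀ + ∫ s in (0 : ℝ)..T, a s‖ ^ 2 =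
      ‖p₀‖ ^ 2 + ∫ t in (0 : ℝ)..T, 2 * inner ℝ (p₀ + ∫ s in (0 : ℝ)..t, a s) (a t) := by
  set p : ℝ → X := fun t => p₀ + ∫ s in (0 : ℝ)..t, a s with hp
  have hpc : ContinuousOn p (uIcc 0 T) :=
    continuousOn_const.add (intervalIntegral.continuousOn_primitive_interval' ha left_mem_uIcc)
  obtain ⟨C, hC⟩ := isCompact_uIcc.exists_bound_of_continuousOn hpc
  have hder : IntervalIntegrable (fun t => 2 * inner ℝ (p t) (a t)) volume 0 T :=
    (intervalIntegrable_inner_of_continuousOn hpc ha).const_mul 2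
  -- As `a` is merely integrable, derivatives exist only almost everywhere and absolute continuity
  -- is required. It is inherited from `∫ ‖a‖`, whose increments dominate those of `‖p‖²` up to
  -- `2C`.
  have hac : AbsolutelyContinuousOnInterval (fun t => ‖p t‖ ^ 2) 0 T := by
    refine absolutelyContinuousOnInterval_of_dist_le (C := 2 * C)
      (ha.norm.absolutelyContinuousOnInterval_intervalIntegral (c := 0) left_mem_uIcc) ?_
    intro x hx y hy
    have hi : ∀ z ∈ uIcc 0 T, IntervalIntegrable a volume 0 z := fun z hz =>
      ha.mono_set (uIcc_subset_uIcc left_mem_uIcc hz)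
    have e1 : p x - p y = ∫ s in y..x, a s := by
      simp only [hp, add_sub_add_left_eq_sub]
      exact intervalIntegral.integral_interval_sub_left (hi x hx) (hi y hy)
    have e2 : (∫ s in (0:ℝ)..x, ‖a s‖) - ∫ s in (0:ℝ)..y, ‖a s‖ = ∫ s in y..x, ‖a s‖ :=
      intervalIntegral.integral_interval_sub_left (hi x hx).norm (hi y hy).norm
    have e3 : ‖p x - p y‖ ≤ |∫ s in y..x, ‖a s‖| := by
      rw [e1]; exact intervalIntegral.norm_integral_le_abs_integral_norm
    rw [Real.dist_eq, Real.dist_eq, e2]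
    have e4 : |‖p x‖ ^ 2 - ‖p y‖ ^ 2| = (‖p x‖ + ‖p y‖) * |‖p x‖ - ‖p y‖| := by
      rw [sq_sub_sq, abs_mul, abs_of_nonneg (by positivity)]
    rw [e4]
    have e5 := abs_norm_sub_norm_le (p x) (p y)
    have := hC x hx
    have := hC y hy
    have : 0 ≤ C := (norm_nonneg _).trans (hC x hx)
    exact mul_le_mul (by linarith) (e5.trans e3) (abs_nonneg _) (by positivity)
  have hac2 := hac.sub (hder.absolutelyContinuousOnInterval_intervalIntegral (c := 0) left_mem_uIcc)
  obtain ⟨c, hc⟩ := hac2.const_of_ae_hasDerivAt_zero (by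
    filter_upwards [ha.ae_hasDerivAt_integral, hder.ae_hasDerivAt_integral] with x h1 h2 hx
    have h3 := ((h1 hx 0 left_mem_uIcc).const_add p₀).norm_sq
    have h4 := h3.sub (h2 hx 0 left_mem_uIcc)
    simpa [hp] using h4)
  have h0 := hc 0 left_mem_uIcc
  have hT := hc T right_mem_uIcc
  simp only [Pi.sub_apply, hp, intervalIntegral.integral_same, add_zero, sub_zero] at h0 hT
  rw [← h0] at hT
  linarith

end Primitive

/-! ### Weak wave equation and its regularized energy balance -/

section WeakWave

variable {V H : Type*} [NormedAddCommGroup V] [InnerProductSpace ℝ V] [CompleteSpace V]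
  [NormedAddCommGroup H] [InnerProductSpace ℝ H] [CompleteSpace H]

/-- `u` (with derivative `w`) is a weak solution of `u'' + A u = g`, `u(0) = u₀`, `u'(0) = u₁`,
written in terms of an embedding `j : V → H` and its adjoint `j† = A⁻¹`. -/
structure IsWeakWave (j : V →L[ℝ] H) (u₀ : V) (u₁ : H) (u : ℝ → V) (w g : ℝ → H) : Prop where
  int_u : ∀ T, 0 ≤ T → IntervalIntegrable u volume 0 T
  int_w : ∀ T, 0 ≤ T → IntervalIntegrable w volume 0 T
  int_g : ∀ T, 0 ≤ T → IntervalIntegrable g volume 0 T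
  eq_u : ∀ᵐ t, 0 < t → j (u t) = j u₀ + ∫ s in (0 : ℝ)..t, w s
  eq_w : ∀ᵐ t, 0 < t → j.adjoint (w t) =
    j.adjoint u₁ + ∫ s in (0 : ℝ)..t, (j.adjoint (g s) - u s)

variable {j : V →L[ℝ] H} {u₀ : V} {u₁ : H} {u : ℝ → V} {w g : ℝ → H}

/-- The regularization of `u`. -/
def regPos (j : V →L[ℝ] H) (R : H →L[ℝ] V) (u₀ : V) (w : ℝ → H) (t : ℝ) : V :=
  R (j u₀ + ∫ s in (0 : ℝ)..t, w s)

/-- The regularization of `u'`. -/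
def regVel (j : V →L[ℝ] H) (R : H →L[ℝ] V) (u₁ : H) (u : ℝ → V) (g : ℝ → H) (t : ℝ) : H :=
  R.adjoint (j.adjoint u₁ + ∫ s in (0 : ℝ)..t, (j.adjoint (g s) - u s))

/-- Only `j† w` satisfies an integrated equation; this identity makes `R†` of it equal to `j (R w)`,
so that `regVel` really regularizes the velocity. -/
theorem adjoint_comp_adjoint {R : H →L[ℝ] V}
    (hR₁ : ∀ h k, inner ℝ (j (R h)) k = inner ℝ h (j (R k))) (h : H) :
    R.adjoint (j.adjoint h) = j (R h) := by
  refine ext_inner_right ℝ fun k => ?_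
  rw [ContinuousLinearMap.adjoint_inner_left, ContinuousLinearMap.adjoint_inner_left, hR₁]

theorem IsWeakWave.int_rhs (hw : IsWeakWave j u₀ u₁ u w g) {T : ℝ} (hT : 0 ≤ T) :
    IntervalIntegrable (fun s => j.adjoint (g s) - u s) volume 0 T := by
  refine IntervalIntegrable.sub ?_ (hw.int_u T hT)
  have := hw.int_g T hT
  rw [intervalIntegrable_iff] at this ⊢
  exact j.adjoint.integrable_comp this

theorem IsWeakWave.continuousOn_regPos (hw : IsWeakWave j u₀ u₁ u w g) (R : H →L[ℝ] V) {T : ℝ}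
    (hT : 0 ≤ T) : ContinuousOn (regPos j R u₀ w) (Icc 0 T) := by
  rw [← uIcc_of_le hT]
  exact R.continuous.comp_continuousOn (continuousOn_const.add
    (intervalIntegral.continuousOn_primitive_interval' (hw.int_w T hT) left_mem_uIcc))

theorem IsWeakWave.continuousOn_regVel (hw : IsWeakWave j u₀ u₁ u w g) (R : H →L[ℝ] V) {T : ℝ}
    (hT : 0 ≤ T) : ContinuousOn (regVel j R u₁ u g) (Icc 0 T) := by
  rw [← uIcc_of_le hT]
  exact R.adjoint.continuous.comp_continuousOn (continuousOn_const.add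
    (intervalIntegral.continuousOn_primitive_interval' (hw.int_rhs hT) left_mem_uIcc))

/-- The energy identity for regularized solutions. -/
theorem IsWeakWave.reg_energy (hw : IsWeakWave j u₀ u₁ u w g) {R : H →L[ℝ] V}
    (hR₁ : ∀ h k, inner ℝ (j (R h)) k = inner ℝ h (j (R k)))
    (hR₂ : ∀ x y, inner ℝ (R (j x)) y = inner ℝ x (R (j y))) {T : ℝ} (hT : 0 ≤ T) :
    ‖regPos j R u₀ w T‖ ^ 2 + ‖regVel j R u₁ u g T‖ ^ 2 = ‖R (j u₀)‖ ^ 2 + ‖j (R u₁)‖ ^ 2 +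
      ∫ t in (0 : ℝ)..T, 2 * inner ℝ (j (R (g t))) (regVel j R u₁ u g t) := by
  have hadj := adjoint_comp_adjoint (j := j) hR₁
  have hi₁ : IntervalIntegrable (fun s => R (w s)) volume 0 T := by
    have := hw.int_w T hT
    rw [intervalIntegrable_iff] at this ⊢
    exact R.integrable_comp this
  have hi₂ : IntervalIntegrable (fun s => R.adjoint (j.adjoint (g s) - u s)) volume 0 T := by
    have := hw.int_rhs hT
    rw [intervalIntegrable_iff] at this ⊢
    exact R.adjoint.integrable_comp this
  have hp : ∀ t ∈ Icc 0 T, regPos j R u₀ w t = R (j u₀) + ∫ s in (0 : ℝ)..t, R (w s) := by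
    intro t ht
    rw [regPos, map_add, ContinuousLinearMap.intervalIntegral_comp_comm _ (hw.int_w t ht.1)]
  have hq : ∀ t ∈ Icc 0 T, regVel j R u₁ u g t =
      j (R u₁) + ∫ s in (0 : ℝ)..t, R.adjoint (j.adjoint (g s) - u s) := by
    intro t ht
    rw [regVel, map_add, ContinuousLinearMap.intervalIntegral_comp_comm _ (hw.int_rhs ht.1), hadj]
  have hTm : T ∈ Icc 0 T := ⟨hT, le_rfl⟩
  rw [hp T hTm, hq T hTm, norm_sq_add_primitive _ hi₁, norm_sq_add_primitive _ hi₂]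
  have hc₁ : ContinuousOn (fun t => R (j u₀) + ∫ s in (0 : ℝ)..t, R (w s)) (uIcc 0 T) :=
    continuousOn_const.add (intervalIntegral.continuousOn_primitive_interval' hi₁ left_mem_uIcc)
  have hc₂ : ContinuousOn (fun t => j (R u₁) +
      ∫ s in (0 : ℝ)..t, R.adjoint (j.adjoint (g s) - u s)) (uIcc 0 T) :=
    continuousOn_const.add (intervalIntegral.continuousOn_primitive_interval' hi₂ left_mem_uIcc)
  rw [add_add_add_comm, ← intervalIntegral.integral_add
    ((intervalIntegrable_inner_of_continuousOn hc₁ hi₁).const_mul 2)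
    ((intervalIntegrable_inner_of_continuousOn hc₂ hi₂).const_mul 2)]
  congr 1
  refine intervalIntegral.integral_congr_ae ?_
  filter_upwards [hw.eq_u, hw.eq_w] with t h1 h2 ht
  rw [uIoc_of_le hT] at ht
  have htm : t ∈ Icc 0 T := ⟨ht.1.le, ht.2⟩
  rw [← hp t htm, ← hq t htm]
  have e1 : regPos j R u₀ w t = R (j (u t)) := by rw [regPos, h1 ht.1]
  have e2 : regVel j R u₁ u g t = j (R (w t)) := by rw [regVel, ← h2 ht.1, hadj]
  -- The potential and kinetic cross terms agree by symmetry of `R ∘ j`, so the operator `A` does no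
  -- net work.
  have e3 : inner ℝ (R (j (u t))) (R (w t)) = inner ℝ (j (R (w t))) (R.adjoint (u t)) := by
    rw [ContinuousLinearMap.adjoint_inner_right, hR₂, real_inner_comm]
  rw [e1, e2, map_sub, inner_sub_right, hadj, e3, real_inner_comm (j (R (g t)))]
  ring

/-- Uniform bound for regularized solutions in terms of the regularized data. -/
theorem IsWeakWave.reg_bound (hw : IsWeakWave j u₀ u₁ u w g) {R : H →L[ℝ] V}
    (hR₁ : ∀ h k, inner ℝ (j (R h)) k = inner ℝ h (j (R k)))
    (hR₂ : ∀ x y, inner ℝ (R (j x)) y = inner ℝ x (R (j y))) {T : ℝ} (hT : 0 ≤ T) {t : ℝ}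
    (ht : t ∈ Icc 0 T) :
    ‖regPos j R u₀ w t‖ ≤
        ‖R (j u₀)‖ + ‖j (R u₁)‖ + 2 * ∫ s in (0 : ℝ)..T, ‖j (R (g s))‖ ∧
      ‖regVel j R u₁ u g t‖ ≤
        ‖R (j u₀)‖ + ‖j (R u₁)‖ + 2 * ∫ s in (0 : ℝ)..T, ‖j (R (g s))‖ := by
  set G := ∫ s in (0 : ℝ)..T, ‖j (R (g s))‖ with hG
  set e : ℝ → ℝ := fun t => ‖regPos j R u₀ w t‖ ^ 2 + ‖regVel j R u₁ u g t‖ ^ 2 with he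
  have hcv := hw.continuousOn_regVel R hT
  have hec : ContinuousOn e (Icc 0 T) :=
    ((hw.continuousOn_regPos R hT).norm.pow 2).add (hcv.norm.pow 2)
  -- Evaluating the balance at a time of maximal energy bounds its integral by `2 S G`, linear in
  -- the maximum `S`.
  obtain ⟨σ, hσ, hmax⟩ := isCompact_Icc.exists_isMaxOn ⟨t, ht⟩ hec
  set S := √(e σ) with hS
  have he0 : ∀ t, 0 ≤ e t := fun t => by positivity
  have hSsq : S ^ 2 = e σ := Real.sq_sqrt (he0 σ)
  have hS0 : 0 ≤ S := Real.sqrt_nonneg _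
  have hle : ∀ s ∈ Icc 0 T, ‖regPos j R u₀ w s‖ ≤ S ∧ ‖regVel j R u₁ u g s‖ ≤ S := by
    intro s hs
    have h1 : e s ≤ S ^ 2 := by rw [hSsq]; exact hmax hs
    simp only [he] at h1
    constructor
    · exact le_of_sq_le_sq (by nlinarith [sq_nonneg ‖regVel j R u₁ u g s‖]) hS0
    · exact le_of_sq_le_sq (by nlinarith [sq_nonneg ‖regPos j R u₀ w s‖]) hS0
  have hig : IntervalIntegrable (fun s => j (R (g s))) volume 0 T := by
    have := hw.int_g T hT
    rw [intervalIntegrable_iff] at this ⊢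
    exact (j ∘L R).integrable_comp this
  have hG0 : 0 ≤ G := intervalIntegral.integral_nonneg hT fun _ _ => norm_nonneg _
  have hint : ∫ t in (0 : ℝ)..σ, 2 * inner ℝ (j (R (g t))) (regVel j R u₁ u g t) ≤ 2 * S * G := by
    have hsub : uIcc 0 σ ⊆ uIcc 0 T := by
      rw [uIcc_of_le hT, uIcc_of_le hσ.1]; exact Icc_subset_Icc_right hσ.2
    have h1 : ∫ t in (0 : ℝ)..σ, 2 * inner ℝ (j (R (g t))) (regVel j R u₁ u g t) ≤
        ∫ t in (0 : ℝ)..σ, 2 * S * ‖j (R (g t))‖ := by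
      refine intervalIntegral.integral_mono_on hσ.1 ?_ ((hig.norm.const_mul _).mono_set hsub) ?_
      · refine IntervalIntegrable.const_mul ?_ 2
        simp_rw [real_inner_comm]
        refine intervalIntegrable_inner_of_continuousOn ?_ (hig.mono_set hsub)
        rw [uIcc_of_le hσ.1]
        exact hcv.mono (Icc_subset_Icc_right hσ.2)
      · intro s hs
        have h2 := (hle s ⟨hs.1, hs.2.trans hσ.2⟩).2
        have h3 := real_inner_le_norm (j (R (g s))) (regVel j R u₁ u g s)
        have h4 := mul_le_mul_of_nonneg_left h2 (norm_nonneg (j (R (g s))))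
        linarith
    refine h1.trans ?_
    rw [intervalIntegral.integral_const_mul]
    gcongr
    exact intervalIntegral.integral_mono_interval le_rfl hσ.1 hσ.2
      (Eventually.of_forall fun _ => norm_nonneg _) hig.norm
  have hen := hw.reg_energy hR₁ hR₂ hσ.1
  have hfin : S ≤ ‖R (j u₀)‖ + ‖j (R u₁)‖ + 2 * G := by
    have h1 : S ^ 2 ≤ ‖R (j u₀)‖ ^ 2 + ‖j (R u₁)‖ ^ 2 + 2 * S * G := by
      rw [hSsq]; simp only [he]; rw [hen]; linarith
    have n1 := norm_nonneg (R (j u₀))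
    have n2 := norm_nonneg (j (R u₁))
    -- Otherwise `S` times the claimed bound would be less than `S²` yet at least `‖R (j u₀)‖² + ‖j
    -- (R u₁)‖² + 2 S G`.
    by_contra hlt
    push Not at hlt
    nlinarith
  exact ⟨(hle t ht).1.trans hfin, (hle t ht).2.trans hfin⟩

end WeakWave

theorem norm_sub_le_add_norm_sub {E : Type*} [SeminormedAddCommGroup E] (a b c : E) :
    ‖a - b‖ ≤ ‖a - c‖ + ‖b - c‖ := by
  simpa only [dist_eq_norm] using dist_triangle_right a b c

/-! ### Passage to the limit in the regularization -/

section WeakWaveLimit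

/-- A locally uniformly Cauchy sequence of continuous functions on `[0,∞)` has a continuous
limit. -/
theorem exists_continuousOn_limit {X : Type*} [NormedAddCommGroup X] [CompleteSpace X]
    {F : ℕ → ℝ → X} (hF : ∀ n T, 0 ≤ T → ContinuousOn (F n) (Icc 0 T))
    (hC : ∀ T, 0 ≤ T → ∃ κ : ℕ → ℝ, Tendsto κ atTop (𝓝 0) ∧
      ∀ n m, ∀ t ∈ Icc 0 T, ‖F n t - F m t‖ ≤ κ n + κ m) :
    ∃ L : ℝ → X, ContinuousOn L (Ici 0) ∧
      ∀ t, 0 ≤ t → Tendsto (fun n => F n t) atTop (𝓝 (L t)) := by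
  have hlim : ∀ t : ℝ, ∃ l, 0 ≤ t → Tendsto (fun n => F n t) atTop (𝓝 l) := by
    intro t
    by_cases ht : 0 ≤ t
    · obtain ⟨κ, hκ, hb⟩ := hC t ht
      have hc : CauchySeq fun n => F n t := by
        rw [Metric.cauchySeq_iff]
        intro ε hε
        obtain ⟨N, hN⟩ := Metric.tendsto_atTop.mp hκ (ε / 2) (by positivity)
        refine ⟨N, fun n hn m hm => ?_⟩
        have h1 := hN n hn
        have h2 := hN m hm
        rw [Real.dist_eq, sub_zero] at h1 h2
        rw [dist_eq_norm]
        have := hb n m t ⟨ht, le_rfl⟩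
        linarith [le_abs_self (κ n), le_abs_self (κ m)]
      obtain ⟨l, hl⟩ := cauchySeq_tendsto_of_complete hc
      exact ⟨l, fun _ => hl⟩
    · exact ⟨0, fun h => absurd h ht⟩
  choose L hL using hlim
  refine ⟨L, ?_, hL⟩
  have hT : ∀ T, 0 ≤ T → ContinuousOn L (Icc 0 T) := by
    intro T hT
    obtain ⟨κ, hκ, hb⟩ := hC T hT
    have hu : TendstoUniformlyOn F L atTop (Icc 0 T) := by
      rw [Metric.tendstoUniformlyOn_iff]
      intro ε hε
      filter_upwards [hκ.eventually (gt_mem_nhds hε)] with n hn t ht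
      rw [dist_comm, dist_eq_norm]
      have h1 : Tendsto (fun m => ‖F n t - F m t‖) atTop (𝓝 ‖F n t - L t‖) :=
        (tendsto_const_nhds.sub (hL t ht.1)).norm
      have h2 : Tendsto (fun m => κ n + κ m) atTop (𝓝 (κ n + 0)) := tendsto_const_nhds.add hκ
      have := le_of_tendsto_of_tendsto' h1 h2 fun m => hb n m t ht
      linarith
    exact hu.continuousOn (Eventually.of_forall fun n => hF n T hT).frequently
  intro t ht
  have h1 : (0 : ℝ) ≤ t + 1 := by linarith [mem_Ici.mp ht]
  refine ((hT (t + 1) h1) t ⟨ht, by linarith⟩).mono_of_mem_nhdsWithin ?_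
  have : Iio (t + 1) ∈ 𝓝 t := Iio_mem_nhds (by linarith)
  filter_upwards [mem_nhdsWithin_of_mem_nhds this, self_mem_nhdsWithin] with s hs hs0
  exact ⟨hs0, le_of_lt hs⟩

variable {V H : Type*} [NormedAddCommGroup V] [InnerProductSpace ℝ V] [CompleteSpace V]
  [NormedAddCommGroup H] [InnerProductSpace ℝ H] [CompleteSpace H]
  {j : V →L[ℝ] H} {u₀ : V} {u₁ : H} {u : ℝ → V} {w g : ℝ → H}

/-- Regularity of weak solutions of the abstract wave equation and the energy identity. -/
theorem IsWeakWave.exists_continuous (hw : IsWeakWave j u₀ u₁ u w g)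
    (hinj : Function.Injective j) (hdense : DenseRange j) :
    ∃ (v : ℝ → V) (z : ℝ → H), ContinuousOn v (Ici 0) ∧ ContinuousOn z (Ici 0) ∧
      (∀ᵐ t, 0 < t → u t = v t ∧ w t = z t) ∧
      (∀ t, 0 ≤ t → j (v t) = j u₀ + ∫ s in (0 : ℝ)..t, w s) ∧
      (∀ t, 0 ≤ t → j.adjoint (z t) =
        j.adjoint u₁ + ∫ s in (0 : ℝ)..t, (j.adjoint (g s) - u s)) ∧
      ∀ t, 0 ≤ t → ‖v t‖ ^ 2 + ‖z t‖ ^ 2 =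
        ‖u₀‖ ^ 2 + ‖u₁‖ ^ 2 + ∫ s in (0 : ℝ)..t, 2 * inner ℝ (g s) (z s) := by
  obtain ⟨R, hR₁, hR₂, hR₃, hR₄, hRV, hRH⟩ := exists_regularizing_sequence j hinj hdense
  have hgm : ∀ T, 0 ≤ T → ∀ n, IntervalIntegrable (fun s => j (R n (g s))) volume 0 T := by
    intro T hT n
    have := hw.int_g T hT
    rw [intervalIntegrable_iff] at this ⊢
    exact (j ∘L R n).integrable_comp this
  have hκ : ∀ T, 0 ≤ T → Tendsto (fun n => ‖R n (j u₀) - u₀‖ + ‖j (R n u₁) - u₁‖ +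
      2 * ∫ s in (0 : ℝ)..T, ‖j (R n (g s)) - g s‖) atTop (𝓝 0) := by
    intro T hT
    have h1 := tendsto_iff_norm_sub_tendsto_zero.mp (hRV u₀)
    have h2 := tendsto_iff_norm_sub_tendsto_zero.mp (hRH u₁)
    have h3 : Tendsto (fun n => ∫ s in (0 : ℝ)..T, ‖j (R n (g s)) - g s‖) atTop
        (𝓝 (∫ s in (0 : ℝ)..T, (0 : ℝ))) := by
      refine intervalIntegral.tendsto_integral_filter_of_dominated_convergence
        (fun s => 2 * ‖g s‖) (Eventually.of_forall fun n => ?_) (Eventually.of_forall fun n => ?_)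
        ((hw.int_g T hT).norm.const_mul 2) ?_
      · exact ((hgm T hT n).sub (hw.int_g T hT)).norm.aestronglyMeasurable_restrict_uIoc
      · refine Eventually.of_forall fun s _ => ?_
        rw [norm_norm]
        have := norm_sub_le (j (R n (g s))) (g s)
        linarith [hR₃ n (g s)]
      · exact Eventually.of_forall fun s _ => tendsto_iff_norm_sub_tendsto_zero.mp (hRH (g s))
    rw [intervalIntegral.integral_zero] at h3
    simpa using (h1.add h2).add (h3.const_mul 2)
  have hcauchy : ∀ T, 0 ≤ T → ∀ n m, ∀ t ∈ Icc 0 T,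
      ‖R n (j u₀) - R m (j u₀)‖ + ‖j (R n u₁) - j (R m u₁)‖ +
        2 * ∫ s in (0 : ℝ)..T, ‖j (R n (g s)) - j (R m (g s))‖ ≤
      (‖R n (j u₀) - u₀‖ + ‖j (R n u₁) - u₁‖ + 2 * ∫ s in (0 : ℝ)..T, ‖j (R n (g s)) - g s‖) +
      (‖R m (j u₀) - u₀‖ + ‖j (R m u₁) - u₁‖ +
        2 * ∫ s in (0 : ℝ)..T, ‖j (R m (g s)) - g s‖) := by
    intro T hT n m t _
    have h1 : ‖R n (j u₀) - R m (j u₀)‖ ≤ ‖R n (j u₀) - u₀‖ + ‖R m (j u₀) - u₀‖ :=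
      norm_sub_le_add_norm_sub _ _ _
    have h2 : ‖j (R n u₁) - j (R m u₁)‖ ≤ ‖j (R n u₁) - u₁‖ + ‖j (R m u₁) - u₁‖ :=
      norm_sub_le_add_norm_sub _ _ _
    have h3 : ∫ s in (0 : ℝ)..T, ‖j (R n (g s)) - j (R m (g s))‖ ≤
        (∫ s in (0 : ℝ)..T, ‖j (R n (g s)) - g s‖) +
          ∫ s in (0 : ℝ)..T, ‖j (R m (g s)) - g s‖ := by
      have i1 := ((hgm T hT n).sub (hw.int_g T hT)).norm
      have i2 := ((hgm T hT m).sub (hw.int_g T hT)).norm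
      rw [← intervalIntegral.integral_add i1 i2]
      exact intervalIntegral.integral_mono_on hT ((hgm T hT n).sub (hgm T hT m)).norm (i1.add i2)
        fun s _ => norm_sub_le_add_norm_sub _ _ _
    linarith
  have hdiff : ∀ T, 0 ≤ T → ∀ n m, ∀ t ∈ Icc 0 T,
      ‖regPos j (R n) u₀ w t - regPos j (R m) u₀ w t‖ ≤
        ‖R n (j u₀) - R m (j u₀)‖ + ‖j (R n u₁) - j (R m u₁)‖ +
          2 * ∫ s in (0 : ℝ)..T, ‖j (R n (g s)) - j (R m (g s))‖ ∧
      ‖regVel j (R n) u₁ u g t - regVel j (R m) u₁ u g t‖ ≤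
        ‖R n (j u₀) - R m (j u₀)‖ + ‖j (R n u₁) - j (R m u₁)‖ +
          2 * ∫ s in (0 : ℝ)..T, ‖j (R n (g s)) - j (R m (g s))‖ := by
    intro T hT n m t ht
    -- `regPos` and `regVel` are linear in `R`, and `R n - R m` has the same symmetries, so the a
    -- priori bound also measures the distance between two regularizations.
    have := hw.reg_bound (R := R n - R m)
      (fun h k => by simp [inner_sub_left, inner_sub_right, hR₁])
      (fun x y => by simp [inner_sub_left, inner_sub_right, hR₂]) hT ht
    simpa [regPos, regVel] using this
  obtain ⟨v, hvc, hv⟩ := exists_continuousOn_limit (F := fun n => regPos j (R n) u₀ w)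
    (fun n T hT => hw.continuousOn_regPos (R n) hT)
    (fun T hT => ⟨_, hκ T hT, fun n m t ht =>
      (hdiff T hT n m t ht).1.trans (hcauchy T hT n m t ht)⟩)
  obtain ⟨z, hzc, hz⟩ := exists_continuousOn_limit (F := fun n => regVel j (R n) u₁ u g)
    (fun n T hT => hw.continuousOn_regVel (R n) hT)
    (fun T hT => ⟨_, hκ T hT, fun n m t ht =>
      (hdiff T hT n m t ht).2.trans (hcauchy T hT n m t ht)⟩)
  have hadj₁ : ∀ n h, (R n).adjoint (j.adjoint h) = j (R n h) := fun n h =>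
    adjoint_comp_adjoint (hR₁ n) h
  have hadj₂ : ∀ n x, j.adjoint ((R n).adjoint x) = R n (j x) := by
    intro n x
    refine ext_inner_right ℝ fun y => ?_
    rw [ContinuousLinearMap.adjoint_inner_left, ContinuousLinearMap.adjoint_inner_left, hR₂]
  refine ⟨v, z, hvc, hzc, ?_, fun t ht => ?_, fun t ht => ?_, fun t ht => ?_⟩
  · filter_upwards [hw.eq_u, hw.eq_w] with t h1 h2 ht
    constructor
    · refine tendsto_nhds_unique ?_ (hv t ht.le)
      simp only [regPos]
      rw [← h1 ht]
      exact hRV (u t)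
    · refine tendsto_nhds_unique ?_ (hz t ht.le)
      simp only [regVel]
      rw [← h2 ht]
      simp only [hadj₁]
      exact hRH (w t)
  · refine tendsto_nhds_unique ((j.continuous.tendsto _).comp (hv t ht)) ?_
    simp only [Function.comp_def, regPos]
    exact hRH _
  · refine tendsto_nhds_unique ((j.adjoint.continuous.tendsto _).comp (hz t ht)) ?_
    simp only [Function.comp_def, regVel, hadj₂]
    exact hRV _
  · have h1 : Tendsto (fun n => ‖regPos j (R n) u₀ w t‖ ^ 2 + ‖regVel j (R n) u₁ u g t‖ ^ 2)
        atTop (𝓝 (‖v t‖ ^ 2 + ‖z t‖ ^ 2)) :=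
      ((hv t ht).norm.pow 2).add ((hz t ht).norm.pow 2)
    refine tendsto_nhds_unique h1 ?_
    refine Tendsto.congr (fun n => (hw.reg_energy (hR₁ n) (hR₂ n) ht).symm) ?_
    refine Tendsto.add (((hRV u₀).norm.pow 2).add ((hRH u₁).norm.pow 2)) ?_
    set C := ‖u₀‖ + ‖u₁‖ + 2 * ∫ s in (0 : ℝ)..t, ‖g s‖ with hCdef
    refine intervalIntegral.tendsto_integral_filter_of_dominated_convergence
      (fun s => 2 * C * ‖g s‖) (Eventually.of_forall fun n => ?_)
      (Eventually.of_forall fun n => ?_) ((hw.int_g t ht).norm.const_mul _) ?_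
    · have h2 := hw.continuousOn_regVel (R n) ht
      rw [← uIcc_of_le ht] at h2
      have := (intervalIntegrable_inner_of_continuousOn h2 (hgm t ht n)).const_mul 2
      refine this.aestronglyMeasurable_restrict_uIoc.congr (Eventually.of_forall fun s => ?_)
      simp only [real_inner_comm (regVel j (R n) u₁ u g s)]
    · refine Eventually.of_forall fun s hs => ?_
      rw [uIoc_of_le ht] at hs
      have h2 := (hw.reg_bound (hR₁ n) (hR₂ n) ht ⟨hs.1.le, hs.2⟩).2
      have h3 : ∫ s in (0 : ℝ)..t, ‖j (R n (g s))‖ ≤ ∫ s in (0 : ℝ)..t, ‖g s‖ :=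
        intervalIntegral.integral_mono_on ht (hgm t ht n).norm (hw.int_g t ht).norm
          fun s _ => hR₃ n _
      have h4 : ‖regVel j (R n) u₁ u g s‖ ≤ C := by
        linarith [hR₄ n u₀, hR₃ n u₁]
      rw [norm_mul, Real.norm_of_nonneg (by norm_num : (0 : ℝ) ≤ 2), mul_assoc]
      gcongr
      calc _ ≤ ‖j (R n (g s))‖ * ‖regVel j (R n) u₁ u g s‖ := norm_inner_le_norm _ _
        _ ≤ ‖g s‖ * C := by gcongr; exact hR₃ n _
        _ = C * ‖g s‖ := mul_comm _ _
    · refine Eventually.of_forall fun s hs => ?_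
      rw [uIoc_of_le ht] at hs
      exact ((hRH (g s)).inner (hz s hs.1.le)).const_mul 2

end WeakWaveLimit

/-! ### Completeness of the energy space and the Riesz identification -/

section EnergySpaceProperties

variable {H : Type*} [NormedAddCommGroup H] [InnerProductSpace ℝ H] [CompleteSpace H]

/-- `A^{1/2} : V → H` as a linear isometry. -/
def sqrtIsometry (𝒜 : CoerciveOperator H) : 𝒜.V →ₗᵢ[ℝ] H :=
  ⟨sqrtMap 𝒜, fun v => (norm_V 𝒜 v).symm⟩

/-- A Cauchy sequence of `V` converges in `H` together with its image under `A^{1/2}`, and the graph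
of a self-adjoint operator is closed. -/
instance (𝒜 : CoerciveOperator H) : CompleteSpace 𝒜.V := by
  refine Metric.complete_of_cauchySeq_tendsto fun x hx => ?_
  obtain ⟨k, hk⟩ := cauchySeq_tendsto_of_complete
    ((sqrtIsometry 𝒜).isometry.uniformContinuous.comp_cauchySeq hx)
  obtain ⟨h, hh⟩ := cauchySeq_tendsto_of_complete ((incl 𝒜).uniformContinuous.comp_cauchySeq hx)
  have hcl : IsClosed (𝒜.sqrt.graph : Set (H × H)) := 𝒜.sqrt_selfAdjoint.isClosed
  have hmem : (h, k) ∈ 𝒜.sqrt.graph :=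
    hcl.mem_of_tendsto (hh.prodMk_nhds hk)
      (Eventually.of_forall fun n => 𝒜.sqrt.mem_graph (x n))
  obtain ⟨y, hy⟩ : ∃ y : 𝒜.V, sqrtIsometry 𝒜 y = k := by
    obtain ⟨y, -, hy⟩ := (LinearPMap.mem_graph_iff _).mp hmem
    exact ⟨y, hy⟩
  refine ⟨y, ?_⟩
  have hk' : Tendsto (fun n => sqrtIsometry 𝒜 (x n)) atTop (𝓝 (sqrtIsometry 𝒜 y)) := by
    rw [hy]
    exact hk
  rw [tendsto_iff_norm_sub_tendsto_zero] at hk' ⊢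
  simpa only [← map_sub, LinearIsometry.norm_map] using hk'

theorem incl_injective (𝒜 : CoerciveOperator H) : Function.Injective (incl 𝒜) :=
  fun _ _ h => Subtype.ext h

theorem denseRange_incl (𝒜 : CoerciveOperator H) : DenseRange (incl 𝒜) := by
  have h : range (incl 𝒜) = (𝒜.sqrt.domain : Set H) := Subtype.range_coe
  rw [DenseRange, h]
  exact 𝒜.sqrt_selfAdjoint.dense_domain

/-- Through Riesz, `H ↪ V'` becomes `j†`, and the extension of `A` becomes the identity of `V`. This
is how the equation in `V'` takes the form used in `IsWeakWave`. -/
theorem toDual_symm_toDualV (𝒜 : CoerciveOperator H) (h : H) :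
    (InnerProductSpace.toDual ℝ 𝒜.V).symm (toDualV 𝒜 h) = (incl 𝒜).adjoint h := by
  rw [LinearIsometryEquiv.symm_apply_eq]
  ext v
  rw [InnerProductSpace.toDual_apply_apply, ContinuousLinearMap.adjoint_inner_left]
  rfl

theorem toDual_symm_opExt (𝒜 : CoerciveOperator H) (v : 𝒜.V) :
    (InnerProductSpace.toDual ℝ 𝒜.V).symm (opExt 𝒜 v) = v := by
  rw [LinearIsometryEquiv.symm_apply_eq]
  rfl

end EnergySpaceProperties

/-! ### Continuity of the nonlinearity -/

section Nonlinearity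

theorem LocLipschitz.continuous {V H : Type*} [NormedAddCommGroup V] [NormedAddCommGroup H]
    {f : V → H} (hf : LocLipschitz f) : Continuous f := by
  rw [continuous_iff_continuousAt]
  intro x
  obtain ⟨L, hL⟩ := hf (‖x‖ + 1) (by positivity)
  rw [ContinuousAt, tendsto_iff_norm_sub_tendsto_zero]
  have h1 : Tendsto (fun y => L * ‖y - x‖) (𝓝 x) (𝓝 0) := by
    have : Continuous fun y => L * ‖y - x‖ := by fun_prop
    simpa using this.tendsto x
  refine squeeze_zero' (Eventually.of_forall fun _ => norm_nonneg _) ?_ h1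
  filter_upwards [Metric.ball_mem_nhds x one_pos] with y hy
  rw [Metric.mem_ball, dist_eq_norm] at hy
  refine hL y x ?_ (by linarith)
  have := norm_le_norm_add_norm_sub' y x
  linarith

end Nonlinearity

/-! ### Integrability and continuity of the feedback terms -/

section Feedback

variable {H U : Type*} [NormedAddCommGroup H] [InnerProductSpace ℝ H] [CompleteSpace H]
  [NormedAddCommGroup U] [InnerProductSpace ℝ U] [CompleteSpace U]

theorem isC1UpTo_of_eq_zero {X : Type*} [NormedAddCommGroup X] [NormedSpace ℝ X] {B : ℝ → X}
    {a b : ℝ} (h : ∀ s ∈ Ico a b, B s = 0) : IsC1UpTo B a b :=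
  ⟨fun _ => 0, contDiffOn_const, h⟩

theorem IsC1UpTo.continuousOn {X : Type*} [NormedAddCommGroup X] [NormedSpace ℝ X] {B : ℝ → X}
    {a b : ℝ} (h : IsC1UpTo B a b) : ContinuousOn B (Ico a b) := by
  obtain ⟨G, hG, hBG⟩ := h
  exact (hG.continuousOn.mono Ico_subset_Icc_self).congr hBG

/-- `s ↦ B(s) B*(s) y(s)` is integrable if `y` is. -/
theorem IsC1UpTo.intervalIntegrable_feedback {B : ℝ → U →L[ℝ] H} {a b : ℝ} (hB : IsC1UpTo B a b)
    (hab : a ≤ b) {y : ℝ → H} (hy : IntervalIntegrable y volume a b) :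
    IntervalIntegrable (fun s => B s ((B s).adjoint (y s))) volume a b := by
  obtain ⟨G, hG, hBG⟩ := hB
  -- The extension `G` is continuous on a compact interval, hence `B B*` is bounded up to the right
  -- end point, where `B` itself is not controlled.
  have hK : ContinuousOn (fun s => G s ∘L (G s).adjoint) (Icc a b) :=
    hG.continuousOn.clm_comp
      (ContinuousLinearMap.adjoint.continuous.comp_continuousOn hG.continuousOn)
  obtain ⟨C, hC⟩ := isCompact_Icc.exists_bound_of_continuousOn hK
  rw [intervalIntegrable_iff_integrableOn_Ioo_of_le hab] at hy ⊢
  have hGi : IntegrableOn (fun s => (G s ∘L (G s).adjoint) (y s)) (Ioo a b) := by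
    refine Integrable.mono' (hy.norm.const_mul C) ?_ ?_
    · exact (ContinuousLinearMap.id ℝ (H →L[ℝ] H)).aestronglyMeasurable_comp₂
        ((hK.mono Ioo_subset_Icc_self).aestronglyMeasurable measurableSet_Ioo) hy.1
    · filter_upwards [ae_restrict_mem measurableSet_Ioo] with s hs
      exact (ContinuousLinearMap.le_opNorm _ _).trans
        (by gcongr; exact hC s (Ioo_subset_Icc_self hs))
  refine hGi.congr_fun (fun s hs => ?_) measurableSet_Ioo
  rw [hBG (Ioo_subset_Ico_self hs)]
  rfl

theorem IsC1UpTo.continuousOn_feedback {B : ℝ → U →L[ℝ] H} {a b : ℝ} (hB : IsC1UpTo B a b)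
    {y : ℝ → H} (hy : ContinuousOn y (Ioo a b)) :
    ContinuousOn (fun s => B s ((B s).adjoint (y s))) (Ioo a b) := by
  have hc := hB.continuousOn.mono Ioo_subset_Ico_self
  exact hc.clm_apply ((ContinuousLinearMap.adjoint.continuous.comp_continuousOn hc).clm_apply hy)

end Feedback

/-! ### From solutions of the delayed problem to regular waves -/

section Regularity

theorem ae_of_forall_ae_restrict_Ioo {P : ℝ → Prop}
    (h : ∀ T : ℝ, 0 < T → ∀ᵐ t ∂volume.restrict (Ioo 0 T), P t) : ∀ᵐ t, 0 < t → P t := by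
  have h1 : ∀ n : ℕ, ∀ᵐ t, t ∈ Ioo (0 : ℝ) (n + 1) → P t := fun n =>
    (ae_restrict_iff' measurableSet_Ioo).mp (h _ (by positivity))
  filter_upwards [ae_all_iff.mpr h1] with t ht h0
  obtain ⟨n, hn⟩ := exists_nat_gt t
  exact ht n ⟨h0, by linarith⟩

theorem intervalIntegrable_of_memLp_two {X : Type*} [NormedAddCommGroup X] {g : ℝ → X} {T : ℝ}
    (hT : 0 ≤ T) (h : MemLp g 2 (volume.restrict (Ioo 0 T))) : IntervalIntegrable g volume 0 T := by
  rw [intervalIntegrable_iff_integrableOn_Ioo_of_le hT]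
  exact h.integrable (by norm_num)

/-- A continuous solution of `u'' + A u = g` in integrated form, with its energy identity. -/
structure IsRegularWave {V H : Type*} [NormedAddCommGroup V] [InnerProductSpace ℝ V]
    [CompleteSpace V] [NormedAddCommGroup H] [InnerProductSpace ℝ H] [CompleteSpace H]
    (j : V →L[ℝ] H) (u₀ : V) (u₁ : H) (v : ℝ → V) (z g : ℝ → H) : Prop where
  cont_v : ContinuousOn v (Ici 0)
  cont_z : ContinuousOn z (Ici 0)
  int_g : ∀ T, 0 ≤ T → IntervalIntegrable g volume 0 T
  eq_v : ∀ s, 0 ≤ s → j (v s) = j u₀ + ∫ r in (0 : ℝ)..s, z r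
  eq_z : ∀ s, 0 ≤ s → j.adjoint (z s) =
    j.adjoint u₁ + ∫ r in (0 : ℝ)..s, (j.adjoint (g r) - v r)
  energy : ∀ s, 0 ≤ s → ‖v s‖ ^ 2 + ‖z s‖ ^ 2 =
    ‖u₀‖ ^ 2 + ‖u₁‖ ^ 2 + ∫ r in (0 : ℝ)..s, 2 * inner ℝ (g r) (z r)

/-- The right-hand side of `u'' + A u = g` along `(u, u')`. -/
def forcing {V H U₁ U₂ : Type*}
    [NormedAddCommGroup H] [InnerProductSpace ℝ H] [CompleteSpace H]
    [NormedAddCommGroup U₁] [InnerProductSpace ℝ U₁] [CompleteSpace U₁]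
    [NormedAddCommGroup U₂] [InnerProductSpace ℝ U₂] [CompleteSpace U₂]
    (f : V → H) (B₁ : ℝ → U₁ →L[ℝ] H) (B₂ : ℝ → U₂ →L[ℝ] H) (τ : ℝ) (v : ℝ → V) (z : ℝ → H)
    (s : ℝ) : H :=
  f (v s) - B₁ s ((B₁ s).adjoint (z s)) - B₂ s ((B₂ s).adjoint (z (s - τ)))

variable {H U₁ U₂ : Type*}
  [NormedAddCommGroup H] [InnerProductSpace ℝ H] [CompleteSpace H]
  [NormedAddCommGroup U₁] [InnerProductSpace ℝ U₁] [CompleteSpace U₁]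
  [NormedAddCommGroup U₂] [InnerProductSpace ℝ U₂] [CompleteSpace U₂]
  {𝒜 : CoerciveOperator H} {f : 𝒜.V → H} {B₁ : ℝ → U₁ →L[ℝ] H} {B₂ : ℝ → U₂ →L[ℝ] H}
  {τ : ℝ} {t : ℕ → ℝ} {u₀ : 𝒜.V} {u₁ : H}

/-- Every even interval has length at least `τ`, so `n τ ≤ t (2n)`. -/
theorem tendsto_times (hτ : 0 < τ) (ht0 : t 0 = 0) (ht : StrictMono t)
    (hτT : ∀ n, τ ≤ len t (2 * n)) : Tendsto t atTop atTop := by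
  have h1 : ∀ n : ℕ, n * τ ≤ t (2 * n) := by
    intro n
    induction n with
    | zero => simp [ht0]
    | succ k ih =>
      have h2 := hτT k
      have h3 : t (2 * k + 1) < t (2 * (k + 1)) := ht (by omega)
      rw [len] at h2
      push_cast
      linarith
  refine tendsto_atTop_atTop.mpr fun b => ?_
  obtain ⟨n, hn⟩ := exists_nat_ge (b / τ)
  refine ⟨2 * n, fun k hk => ?_⟩
  rw [div_le_iff₀ hτ] at hn
  exact hn.trans ((h1 n).trans (ht.monotone hk))

/-- The forcing is integrable piece by piece. On odd intervals `s - τ` stays nonnegative because the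
preceding even interval is at least `τ` long; on even intervals the delayed term vanishes. -/
theorem intervalIntegrable_forcing (hτ : 0 < τ) (ht0 : t 0 = 0) (ht : StrictMono t)
    (hτT : ∀ n, τ ≤ len t (2 * n))
    (hB₂zero : ∀ n, ∀ s ∈ Ico (t (2 * n)) (t (2 * n + 1)), B₂ s = 0)
    (hB₁C1 : ∀ n, IsC1UpTo B₁ (t n) (t (n + 1)))
    (hB₂C1 : ∀ n, IsC1UpTo B₂ (t n) (t (n + 1))) {v : ℝ → 𝒜.V} {z : ℝ → H}
    (hfv : ∀ T, 0 ≤ T → IntervalIntegrable (fun s => f (v s)) volume 0 T)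
    (hz : ∀ T, 0 ≤ T → IntervalIntegrable z volume 0 T) {T : ℝ} (hT : 0 ≤ T) :
    IntervalIntegrable (forcing f B₁ B₂ τ v z) volume 0 T := by
  have hpos : ∀ n, 0 ≤ t n := fun n => ht0 ▸ ht.monotone (Nat.zero_le n)
  have hsub : ∀ {X : Type _} [NormedAddCommGroup X] {y : ℝ → X} {a b : ℝ},
      (∀ T, 0 ≤ T → IntervalIntegrable y volume 0 T) → 0 ≤ a → 0 ≤ b →
      IntervalIntegrable y volume a b := fun hy ha hb => (hy _ ha).symm.trans (hy _ hb)
  have hstep : ∀ n, IntervalIntegrable (forcing f B₁ B₂ τ v z) volume (t n) (t (n + 1)) := by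
    intro n
    have hn : t n ≤ t (n + 1) := (ht (Nat.lt_succ_self n)).le
    refine ((hsub hfv (hpos n) (hpos _)).sub ((hB₁C1 n).intervalIntegrable_feedback hn
      (hsub hz (hpos n) (hpos _)))).sub ?_
    rcases Nat.even_or_odd' n with ⟨k, rfl | rfl⟩
    · rw [intervalIntegrable_iff_integrableOn_Ioo_of_le hn]
      refine (integrableOn_zero (μ := volume)).congr_fun (fun s hs => ?_) measurableSet_Ioo
      rw [hB₂zero k s (Ioo_subset_Ico_self hs)]
      simp
    · refine (hB₂C1 _).intervalIntegrable_feedback hn ?_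
      have h1 := hτT k
      rw [len] at h1
      have := (hsub hz (a := t (2 * k + 1) - τ) (b := t (2 * k + 1 + 1) - τ)
        (by linarith [hpos (2 * k)]) (by linarith [hpos (2 * k)])).comp_sub_right τ
      simpa using this
  obtain ⟨N, hN⟩ := ((tendsto_times hτ ht0 ht hτT).eventually (eventually_ge_atTop T)).exists
  have hall := IntervalIntegrable.trans_iterate (a := t) (n := N) fun k _ => hstep k
  rw [ht0] at hall
  refine hall.mono_set ?_
  rw [uIcc_of_le hT, uIcc_of_le (hpos N)]
  exact Icc_subset_Icc_right hN

/-- Solutions have a representative in `C([0,∞);V) ∩ C¹([0,∞);H)` satisfying the integrated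
equation and the energy identity. -/
theorem IsSolution.exists_regular (hτ : 0 < τ) (ht0 : t 0 = 0)
    (ht : StrictMono t) (hτT : ∀ n, τ ≤ len t (2 * n))
    (hB₂zero : ∀ n, ∀ s ∈ Ico (t (2 * n)) (t (2 * n + 1)), B₂ s = 0)
    (hB₁C1 : ∀ n, IsC1UpTo B₁ (t n) (t (n + 1)))
    (hB₂C1 : ∀ n, IsC1UpTo B₂ (t n) (t (n + 1))) {u : ℝ → 𝒜.V} {ut : ℝ → H}
    (hu : IsSolution 𝒜 f B₁ B₂ τ u₀ u₁ u ut) :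
    ∃ (v : ℝ → 𝒜.V) (z : ℝ → H), (∀ᵐ s, 0 < s → u s = v s ∧ ut s = z s) ∧
      IsRegularWave (incl 𝒜) u₀ u₁ v z (forcing f B₁ B₂ τ v z) := by
  obtain ⟨utt, hutt⟩ := hu
  have hpos' : ∀ {X : Type _} [NormedAddCommGroup X] {y : ℝ → X},
      (∀ T, 0 < T → MemLp y 2 (volume.restrict (Ioo 0 T))) → ∀ T, 0 ≤ T →
      IntervalIntegrable y volume 0 T := by
    intro X _ y hy T hT
    rcases hT.eq_or_lt with rfl | hT
    · exact IntervalIntegrable.refl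
    · exact intervalIntegrable_of_memLp_two hT.le (hy T hT)
  have hiu := hpos' fun T hT => (hutt T hT).1
  have hiut := hpos' fun T hT => (hutt T hT).2.1.memLp_deriv
  have hiutt := hpos' fun T hT => (hutt T hT).2.2.1.memLp_deriv
  have hif := hpos' fun T hT => (hutt T hT).2.2.2.2.2.2.2.2.1
  have hig := fun (T : ℝ) (hT : 0 ≤ T) =>
    intervalIntegrable_forcing hτ ht0 ht hτT hB₂zero hB₁C1 hB₂C1 hif hiut hT
  have heq := ae_of_forall_ae_restrict_Ioo fun T hT => (hutt T hT).2.2.2.2.2.2.2.2.2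
  have hwave : IsWeakWave (incl 𝒜) u₀ u₁ u ut (forcing f B₁ B₂ τ u ut) := by
    refine ⟨hiu, hiut, hig,
      ae_of_forall_ae_restrict_Ioo fun T hT => (hutt T hT).2.1.eq_primitive, ?_⟩
    have h1 := ae_of_forall_ae_restrict_Ioo fun T hT => (hutt T hT).2.2.1.eq_primitive
    filter_upwards [h1] with s hs hs0
    have h2 := congrArg (InnerProductSpace.toDual ℝ 𝒜.V).symm (hs hs0)
    rw [map_add, toDual_symm_toDualV, toDual_symm_toDualV] at h2
    rw [h2]
    congr 1
    have hcong : ∀ᵐ r, r ∈ uIoc 0 s → (InnerProductSpace.toDual ℝ 𝒜.V).symm (utt r) =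
        (incl 𝒜).adjoint (forcing f B₁ B₂ τ u ut r) - u r := by
      filter_upwards [heq] with r hr hr0
      rw [uIoc_of_le hs0.le] at hr0
      have h4 := congrArg (InnerProductSpace.toDual ℝ 𝒜.V).symm (hr hr0.1)
      simp only [map_add, toDual_symm_toDualV, toDual_symm_opExt] at h4
      simp only [forcing, map_sub, ← h4]
      abel
    have hrhs : IntervalIntegrable (fun r => (incl 𝒜).adjoint (forcing f B₁ B₂ τ u ut r) - u r)
        volume 0 s := by
      refine IntervalIntegrable.sub ?_ (hiu s hs0.le)
      have := hig s hs0.le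
      rw [intervalIntegrable_iff] at this ⊢
      exact (incl 𝒜).adjoint.integrable_comp this
    -- Testing with a fixed `y` reduces the `V'`-valued and the `V`-valued integral to the same
    -- scalar integral.
    refine ext_inner_right ℝ fun y => ?_
    rw [InnerProductSpace.toDual_symm_apply,
      ContinuousLinearMap.intervalIntegral_apply (hiutt s hs0.le), real_inner_comm,
      ← innerSL_apply_apply ℝ y, ← ContinuousLinearMap.intervalIntegral_comp_comm _ hrhs]
    refine intervalIntegral.integral_congr_ae ?_
    filter_upwards [hcong] with r hr hr0
    rw [← hr hr0, innerSL_apply_apply, real_inner_comm, InnerProductSpace.toDual_symm_apply]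
  obtain ⟨v, z, hv, hz, hae, h1, h2, h3⟩ :=
    hwave.exists_continuous (incl_injective 𝒜) (denseRange_incl 𝒜)
  -- The delayed argument is handled by translation invariance of null sets when `s > τ`; when `s <
  -- τ ≤ t 1` the operator `B₂ s` is zero, so values at negative times do not matter.
  have hforce : ∀ᵐ s, 0 < s → forcing f B₁ B₂ τ u ut s = forcing f B₁ B₂ τ v z s := by
    have hshift : ∀ᵐ s, 0 < s - τ → u (s - τ) = v (s - τ) ∧ ut (s - τ) = z (s - τ) :=
      (measurePreserving_sub_right volume τ).quasiMeasurePreserving.ae hae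
    filter_upwards [hae, hshift, Measure.ae_ne volume τ] with s hs1 hs2 hs3 hs0
    rw [forcing, forcing, (hs1 hs0).1, (hs1 hs0).2]
    rcases lt_or_gt_of_ne hs3 with hlt | hgt
    · have : B₂ s = 0 := by
        have h4 := hτT 0
        rw [len, mul_zero, zero_add, ht0] at h4
        exact hB₂zero 0 s (by simp only [mul_zero, ht0, zero_add]; exact ⟨hs0.le, by linarith⟩)
      simp [this]
    · rw [(hs2 (by linarith)).2]
  have hrestr : ∀ {P : ℝ → Prop} {T : ℝ}, 0 ≤ T → (∀ᵐ s, 0 < s → P s) →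
      ∀ᵐ s, s ∈ uIoc 0 T → P s := by
    intro P T hT h
    filter_upwards [h] with s hs hs'
    rw [uIoc_of_le hT] at hs'
    exact hs hs'.1
  refine ⟨v, z, hae, hv, hz, fun T hT => ?_, fun s hs => ?_, fun s hs => ?_, fun s hs => ?_⟩
  · exact (hig T hT).congr_ae ((ae_restrict_iff' measurableSet_uIoc).mpr (hrestr hT hforce))
  · rw [h1 s hs]
    congr 1
    refine intervalIntegral.integral_congr_ae (hrestr hs ?_)
    filter_upwards [hae] with r hr hr0 using (hr hr0).2
  · rw [h2 s hs]
    congr 1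
    refine intervalIntegral.integral_congr_ae (hrestr hs ?_)
    filter_upwards [hae, hforce] with r hr hr' hr0
    rw [hr' hr0, (hr hr0).1]
  · rw [h3 s hs]
    congr 1
    refine intervalIntegral.integral_congr_ae (hrestr hs ?_)
    filter_upwards [hforce] with r hr' hr0
    rw [hr' hr0]

end Regularity

/-! ### Monotonicity from derivatives and sign of the potential -/

section Calculus

theorem antitoneOn_Icc_of_hasDerivAt_nonpos {p p' : ℝ → ℝ} {a b : ℝ}
    (hc : ContinuousOn p (Icc a b)) (hd : ∀ s ∈ Ioo a b, HasDerivAt p (p' s) s)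
    (hneg : ∀ s ∈ Ioo a b, p' s ≤ 0) : AntitoneOn p (Icc a b) := by
  refine antitoneOn_of_deriv_nonpos (convex_Icc a b) hc ?_ ?_ <;> rw [interior_Icc]
  · exact fun s hs => (hd s hs).differentiableAt.differentiableWithinAt
  · intro s hs
    rw [(hd s hs).deriv]
    exact hneg s hs

theorem hasDerivAt_integral_of_continuousOn_Ioo {X : Type*} [NormedAddCommGroup X]
    [NormedSpace ℝ X] [CompleteSpace X] {φ : ℝ → X} {a b c s : ℝ}
    (hi : IntervalIntegrable φ volume c s) (hc : ContinuousOn φ (Ioo a b)) (hs : s ∈ Ioo a b) :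
    HasDerivAt (fun t => ∫ r in c..t, φ r) (φ s) s :=
  intervalIntegral.integral_hasDerivAt_right hi (hc.stronglyMeasurableAtFilter isOpen_Ioo s hs)
    (hc.continuousAt (isOpen_Ioo.mem_nhds hs))

/-- A potential with `⟨f(x), x⟩ ≤ 0` is nonpositive. -/
theorem potential_nonpos {V H : Type*} [NormedAddCommGroup V] [NormedSpace ℝ V]
    [NormedAddCommGroup H] [InnerProductSpace ℝ H] {j : V →L[ℝ] H} {F : V → ℝ} {f : V → H} (hF0 : F 0 = 0)
    (hF : ∀ x, HasFDerivAt F ((innerSL ℝ (f x)).comp j) x)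
    (hsign : ∀ x, inner ℝ (f x) (j x) ≤ 0) (x : V) : F x ≤ 0 := by
  have hd : ∀ θ : ℝ, HasDerivAt (fun θ : ℝ => F (θ • x)) (inner ℝ (f (θ • x)) (j x)) θ := by
    intro θ
    have h1 : HasDerivAt (fun θ : ℝ => θ • x) x θ := by
      simpa using (hasDerivAt_id θ).smul_const x
    exact (hF (θ • x)).comp_hasDerivAt θ h1
  have hanti := antitoneOn_Icc_of_hasDerivAt_nonpos (a := 0) (b := 1)
    (fun θ _ => (hd θ).continuousAt.continuousWithinAt) (fun θ _ => hd θ) (fun θ hθ => by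
      -- For `θ > 0` the derivative of `F (θ x)` is `θ⁻¹ ⟨f(θ x), θ x⟩`, hence nonpositive.
      have h1 := hsign (θ • x)
      rw [map_smul, real_inner_smul_right] at h1
      by_contra hlt
      push Not at hlt
      exact absurd h1 (not_le.mpr (mul_pos hθ.1 hlt)))
  have := hanti (left_mem_Icc.mpr zero_le_one) (right_mem_Icc.mpr zero_le_one) zero_le_one
  simpa [hF0] using this

end Calculus

/-! ### Differentiation along a regular wave -/

section Wave

variable {V H : Type*} [NormedAddCommGroup V] [InnerProductSpace ℝ V] [CompleteSpace V]
  [NormedAddCommGroup H] [InnerProductSpace ℝ H] [CompleteSpace H]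
  {j : V →L[ℝ] H} {u₀ : V} {u₁ : H} {v : ℝ → V} {z g : ℝ → H} {a b s : ℝ}

namespace IsRegularWave

theorem hasDerivWithinAt_pos (hw : IsRegularWave j u₀ u₁ v z g) (hs : 0 ≤ s) :
    HasDerivWithinAt (fun r => j (v r)) (z s) (Ici 0) s := by
  -- Freezing `z` to the left of `0` makes it continuous on the whole line without changing any
  -- integral over `[0,t]`, which covers the one-sided derivative at `0`.
  have hc : Continuous fun r => z (max r 0) :=
    hw.cont_z.comp_continuous (by fun_prop) fun r => le_max_right r 0
  have h1 : HasDerivAt (fun t => j u₀ + ∫ r in (0 : ℝ)..t, z (max r 0)) (z (max s 0)) s :=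
    (intervalIntegral.integral_hasDerivAt_right (hc.intervalIntegrable _ _)
      (hc.stronglyMeasurableAtFilter _ _) hc.continuousAt).const_add _
  rw [max_eq_left hs] at h1
  have h2 : ∀ t ∈ Ici (0 : ℝ), j (v t) = j u₀ + ∫ r in (0 : ℝ)..t, z (max r 0) := by
    intro t ht
    rw [hw.eq_v t ht]
    congr 1
    refine intervalIntegral.integral_congr fun r hr => ?_
    rw [uIcc_of_le ht] at hr
    simp only [max_eq_left hr.1]
  exact h1.hasDerivWithinAt.congr h2 (h2 s hs)

theorem hasDerivAt_pos (hw : IsRegularWave j u₀ u₁ v z g) (hs : 0 < s) :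
    HasDerivAt (fun r => j (v r)) (z s) s :=
  (hw.hasDerivWithinAt_pos hs.le).hasDerivAt (Ici_mem_nhds hs)

/-- The curve `z` need not be differentiable in `H`; after applying `j†`, the integrated equation
can be differentiated wherever `g` is continuous. -/
theorem hasDerivAt_vel (hw : IsRegularWave j u₀ u₁ v z g) (ha : 0 ≤ a)
    (hg : ContinuousOn g (Ioo a b)) (hs : s ∈ Ioo a b) :
    HasDerivAt (fun r => j.adjoint (z r)) (j.adjoint (g s) - v s) s := by
  have hs0 : 0 < s := ha.trans_lt hs.1
  have hsub : Ioo a b ⊆ Ici 0 := fun r hr => ha.trans hr.1.le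
  have hi : IntervalIntegrable (fun r => j.adjoint (g r) - v r) volume 0 s := by
    refine IntervalIntegrable.sub ?_ ?_
    · have := hw.int_g s hs0.le
      rw [intervalIntegrable_iff] at this ⊢
      exact j.adjoint.integrable_comp this
    · refine (hw.cont_v.mono ?_).intervalIntegrable
      rw [uIcc_of_le hs0.le]
      exact Icc_subset_Ici_self
  have h1 := (hasDerivAt_integral_of_continuousOn_Ioo hi
    ((j.adjoint.continuous.comp_continuousOn hg).sub (hw.cont_v.mono hsub)) hs).const_add
    (j.adjoint u₁)
  refine h1.congr_of_eventuallyEq ?_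
  filter_upwards [Ioi_mem_nhds hs0] with r hr using hw.eq_z r (le_of_lt hr)

theorem hasDerivAt_norm_sq (hw : IsRegularWave j u₀ u₁ v z g) (ha : 0 ≤ a)
    (hg : ContinuousOn g (Ioo a b)) (hs : s ∈ Ioo a b) :
    HasDerivAt (fun r => ‖v r‖ ^ 2 + ‖z r‖ ^ 2) (2 * inner ℝ (g s) (z s)) s := by
  have hs0 : 0 < s := ha.trans_lt hs.1
  have hsub : Ioo a b ⊆ Ici 0 := fun r hr => ha.trans hr.1.le
  have hi : IntervalIntegrable (fun r => 2 * inner ℝ (g r) (z r)) volume 0 s := by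
    have hz : ContinuousOn z (uIcc 0 s) := by
      rw [uIcc_of_le hs0.le]
      exact hw.cont_z.mono Icc_subset_Ici_self
    refine ((intervalIntegrable_inner_of_continuousOn hz (hw.int_g s hs0.le)).congr
      fun r _ => ?_).const_mul 2
    exact real_inner_comm _ _
  have h1 := (hasDerivAt_integral_of_continuousOn_Ioo hi
    (continuousOn_const.mul (hg.inner (hw.cont_z.mono hsub))) hs).const_add
    (‖u₀‖ ^ 2 + ‖u₁‖ ^ 2)
  refine h1.congr_of_eventuallyEq ?_
  filter_upwards [Ioi_mem_nhds hs0] with r hr using hw.energy r (le_of_lt hr)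

/-- This is the multiplier `⟨u_t, u⟩`. Its difference quotient splits into `z r` against the
quotient of `j v`, and the quotient of `j† z` against the fixed vector `v s`, so differentiability
of `z` in `H` is not needed. -/
theorem hasDerivAt_inner (hw : IsRegularWave j u₀ u₁ v z g) (ha : 0 ≤ a)
    (hg : ContinuousOn g (Ioo a b)) (hs : s ∈ Ioo a b) :
    HasDerivAt (fun r => inner ℝ (z r) (j (v r)))
      (‖z s‖ ^ 2 - ‖v s‖ ^ 2 + inner ℝ (g s) (j (v s))) s := by
  have hs0 : 0 < s := ha.trans_lt hs.1
  have h1 := hasDerivAt_iff_tendsto_slope.mp (hw.hasDerivAt_pos hs0)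
  have h2 := hasDerivAt_iff_tendsto_slope.mp (hw.hasDerivAt_vel ha hg hs)
  have hz : Tendsto z (𝓝[≠] s) (𝓝 (z s)) :=
    (hw.cont_z.continuousAt (Ici_mem_nhds hs0)).tendsto.mono_left nhdsWithin_le_nhds
  rw [hasDerivAt_iff_tendsto_slope]
  have h3 := (hz.inner (𝕜 := ℝ) h1).add (h2.inner (𝕜 := ℝ) (tendsto_const_nhds (x := v s)))
  have e : ‖z s‖ ^ 2 - ‖v s‖ ^ 2 + inner ℝ (g s) (j (v s)) =
      inner ℝ (z s) (z s) + inner ℝ (j.adjoint (g s) - v s) (v s) := by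
    rw [inner_sub_left, ContinuousLinearMap.adjoint_inner_left, real_inner_self_eq_norm_sq,
      real_inner_self_eq_norm_sq]
    ring
  rw [e]
  refine h3.congr fun r => ?_
  simp only [slope, vsub_eq_sub, real_inner_smul_left, real_inner_smul_right, inner_sub_left,
    inner_sub_right, ContinuousLinearMap.adjoint_inner_left, smul_eq_mul]
  ring

/-- The chain rule for a potential whose gradient is bounded in the weaker norm. -/
theorem hasDerivAt_potential (hw : IsRegularWave j u₀ u₁ v z g) {F : V → ℝ} {f : V → H}
    (hf : Continuous f) (hF : ∀ x, HasFDerivAt F ((innerSL ℝ (f x)).comp j) x) (hs : 0 < s) :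
    HasDerivAt (fun r => F (v r)) (inner ℝ (f (v s)) (z s)) s := by
  -- Since `v` need not be differentiable in `V`, the usual chain rule does not apply. The mean
  -- value theorem puts the increment in `H`, where `j v` is differentiable, and `ξ r → v s` with
  -- `f` continuous.
  have hmv : ∀ r, ∃ ξ ∈ segment ℝ (v s) (v r),
      F (v r) - F (v s) = inner ℝ (f ξ) (j (v r) - j (v s)) := by
    intro r
    obtain ⟨ξ, hξ, h⟩ := domain_mvt (s := univ) (fun x _ => (hF x).hasFDerivWithinAt)
      convex_univ (mem_univ (v s)) (mem_univ (v r))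
    refine ⟨ξ, hξ, ?_⟩
    rw [h, ContinuousLinearMap.comp_apply, innerSL_apply_apply, map_sub]
  choose ξ hξ hFξ using hmv
  have hv : Tendsto v (𝓝[≠] s) (𝓝 (v s)) :=
    (hw.cont_v.continuousAt (Ici_mem_nhds hs)).tendsto.mono_left nhdsWithin_le_nhds
  have hξv : Tendsto ξ (𝓝[≠] s) (𝓝 (v s)) := by
    rw [tendsto_iff_norm_sub_tendsto_zero] at hv ⊢
    refine squeeze_zero (fun _ => norm_nonneg _) (fun r => ?_) hv
    obtain ⟨θ, hθ, hθξ⟩ := (segment_eq_image' ℝ (v s) (v r)).subset (hξ r)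
    simp only at hθξ
    rw [← hθξ, add_sub_cancel_left, norm_smul, Real.norm_of_nonneg hθ.1]
    exact mul_le_of_le_one_left (norm_nonneg _) hθ.2
  have h1 := hasDerivAt_iff_tendsto_slope.mp (hw.hasDerivAt_pos hs)
  rw [hasDerivAt_iff_tendsto_slope]
  refine (((hf.tendsto (v s)).comp hξv).inner h1).congr fun r => ?_
  simp only [slope, vsub_eq_sub, real_inner_smul_right, smul_eq_mul, Function.comp_apply, hFξ]

end IsRegularWave

end Wave

/-! ### Scalar decay and growth inequalities -/

section RealInequalities

/-- Decay of an energy with dissipation `d` over `[a,b]`, by means of a multiplier `X`. -/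
theorem multiplier_decay {E X X' d : ℝ → ℝ} {a b lam m M : ℝ} (hab : a < b) (hlam : 0 < lam)
    (hm : 0 < m) (hM : 0 < M) (hEc : ContinuousOn E (Icc a b)) (hXc : ContinuousOn X (Icc a b))
    (hE : ∀ s ∈ Ioo a b, HasDerivAt E (-d s) s) (hX : ∀ s ∈ Ioo a b, HasDerivAt X (X' s) s)
    (hd : ∀ s ∈ Ioo a b, 0 ≤ d s)
    (hkey : ∀ s ∈ Ioo a b, ∀ φ φ' : ℝ, 0 ≤ φ → φ' ^ 2 ≤ 4 * (b - a) ^ 2 * φ →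
      φ' * X s + φ * (X' s + E s) ≤
        (4 * (b - a) ^ 2 / (lam * m) + φ * (3 / (2 * m) + M / lam)) * d s) :
    E b ≤ 1 / (1 + (b - a) ^ 3 / 30 * (1 / (4 / (lam * m) + 3 * (b - a) ^ 2 / (32 * m)
      + M * (b - a) ^ 2 / (16 * lam)))) * E a := by
  set T := b - a with hT
  have hT0 : 0 < T := sub_pos.mpr hab
  set D := 4 / (lam * m) + 3 * T ^ 2 / (32 * m) + M * T ^ 2 / (16 * lam) with hD
  have hD0 : 0 < D := by positivity
  have hEanti : AntitoneOn E (Icc a b) :=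
    antitoneOn_Icc_of_hasDerivAt_nonpos hEc hE fun s hs => neg_nonpos.mpr (hd s hs)
  -- The double zeros remove the boundary terms and give `φ'² ≤ 4 T² φ`, so that `φ' X` can be
  -- absorbed by terms weighted with `φ`. The primitive `P` has `P b = T⁵ / 30`.
  set φ : ℝ → ℝ := fun s => (s - a) ^ 2 * (b - s) ^ 2 with hφ
  set φ' : ℝ → ℝ := fun s => 2 * (s - a) * (b - s) * ((b - s) - (s - a)) with hφ'
  set P : ℝ → ℝ := fun s =>
    T ^ 2 * (s - a) ^ 3 / 3 - T * (s - a) ^ 4 / 2 + (s - a) ^ 5 / 5 with hP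
  have hφd : ∀ s, HasDerivAt φ (φ' s) s := by
    intro s
    have h1 : HasDerivAt (fun s : ℝ => s - a) 1 s := (hasDerivAt_id s).sub_const a
    have h2 : HasDerivAt (fun s : ℝ => b - s) (-1) s := (hasDerivAt_id s).const_sub b
    refine ((h1.pow 2).mul (h2.pow 2)).congr_deriv ?_
    simp only [hφ', Pi.pow_apply]
    push_cast
    ring
  have hPd : ∀ s, HasDerivAt P (φ s) s := by
    intro s
    have h1 : HasDerivAt (fun s : ℝ => s - a) 1 s := (hasDerivAt_id s).sub_const a
    refine (((((h1.pow 3).const_mul (T ^ 2)).div_const 3).sub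
      (((h1.pow 4).const_mul T).div_const 2)).add ((h1.pow 5).div_const 5)).congr_deriv ?_
    simp only [hφ, hT]
    push_cast
    ring
  have hφc : Continuous φ := by fun_prop
  have hPc : Continuous P := by fun_prop
  -- This function decreases because `E b ≤ E s` turns `φ E b` into the `φ E` of `hkey`, whose bound
  -- is paid for by the dissipation in `T² D E`. Comparing end points leaves `(T² D + T⁵/30) E b ≤
  -- T² D E a`.
  have hanti : AntitoneOn (fun s => φ s * X s + T ^ 2 * D * E s + P s * E b) (Icc a b) := by
    refine antitoneOn_Icc_of_hasDerivAt_nonpos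
      (p' := fun s => φ' s * X s + φ s * X' s + T ^ 2 * D * (-d s) + φ s * E b) ?_ ?_ ?_
    · exact ((hφc.continuousOn.mul hXc).add (continuousOn_const.mul hEc)).add
        (hPc.continuousOn.mul continuousOn_const)
    · intro s hs
      exact (((hφd s).mul (hX s hs)).add ((hE s hs).const_mul _)).add ((hPd s).mul_const _)
    · intro s hs
      have hsa : 0 ≤ s - a := sub_nonneg.mpr hs.1.le
      have hsb : 0 ≤ b - s := sub_nonneg.mpr hs.2.le
      have hφ0 : 0 ≤ φ s := by positivity
      have hsT : (s - a) + (b - s) = T := by rw [hT]; ring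
      have hφT : φ s ≤ T ^ 4 / 16 := by
        have h1 : (s - a) * (b - s) ≤ T ^ 2 / 4 := by
          rw [← hsT]; nlinarith [sq_nonneg ((s - a) - (b - s))]
        calc φ s = ((s - a) * (b - s)) ^ 2 := by rw [hφ]; ring
          _ ≤ (T ^ 2 / 4) ^ 2 := by gcongr
          _ = T ^ 4 / 16 := by ring
      have hφ'2 : φ' s ^ 2 ≤ 4 * T ^ 2 * φ s := by
        have h1 : ((b - s) - (s - a)) ^ 2 ≤ T ^ 2 := by
          rw [← hsT]; nlinarith [mul_nonneg hsa hsb]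
        calc φ' s ^ 2 = 4 * φ s * ((b - s) - (s - a)) ^ 2 := by simp only [hφ', hφ]; ring
          _ ≤ 4 * φ s * T ^ 2 := by gcongr
          _ = _ := by ring
      have h1 := hkey s hs (φ s) (φ' s) hφ0 hφ'2
      have h2 : E b ≤ E s := hEanti (Ioo_subset_Icc_self hs) (right_mem_Icc.mpr hab.le) hs.2.le
      have h3 : (4 * T ^ 2 / (lam * m) + φ s * (3 / (2 * m) + M / lam)) * d s ≤
          T ^ 2 * D * d s := by
        refine mul_le_mul_of_nonneg_right ?_ (hd s hs)
        -- The bound `φ ≤ T⁴/16` produces the coefficients `3/32` and `1/16` of `D`.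
        calc _ ≤ 4 * T ^ 2 / (lam * m) + T ^ 4 / 16 * (3 / (2 * m) + M / lam) := by gcongr
          _ = T ^ 2 * D := by rw [hD]; field_simp; ring
      have h4 := mul_le_mul_of_nonneg_left h2 hφ0
      linarith
  have h := hanti (left_mem_Icc.mpr hab.le) (right_mem_Icc.mpr hab.le) hab.le
  have e1 : φ a = 0 := by simp [hφ]
  have e2 : φ b = 0 := by simp [hφ]
  have e3 : P a = 0 := by simp [hP]
  have e4 : P b = T ^ 5 / 30 := by simp only [hP, ← hT]; ring
  simp only [e1, e2, e3, e4] at h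
  have h5 : (1 + T ^ 3 / 30 * (1 / D)) * E b ≤ E a := by
    have : T ^ 2 * D * ((1 + T ^ 3 / 30 * (1 / D)) * E b) ≤ T ^ 2 * D * E a := by
      calc _ = T ^ 2 * D * E b + T ^ 5 / 30 * E b := by field_simp
        _ ≤ _ := by linarith
    exact le_of_mul_le_mul_left this (by positivity)
  have h6 : 0 < 1 + T ^ 3 / 30 * (1 / D) := by positivity
  rw [one_div, inv_mul_eq_div, le_div_iff₀ h6]
  linarith

/-- Growth of an energy `E` on `[a,b]` under a delayed feedback. -/
theorem delayed_growth {E E' N : ℝ → ℝ} {a b τ M E₀ : ℝ} (hab : a ≤ b) (hτ : 0 < τ) (hM : 0 ≤ M)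
    (hEc : ContinuousOn E (Icc a b)) (hNc : ContinuousOn N (Icc (a - τ) b))
    (hE : ∀ s ∈ Ioo a b, HasDerivAt E (E' s) s)
    (hE' : ∀ s ∈ Ioo a b, E' s ≤ M / 2 * (N (s - τ) + N s)) (hN : ∀ s ∈ Icc (a - τ) b, 0 ≤ N s)
    (hNE : ∀ s ∈ Icc a b, N s ≤ 2 * E s) (hNE₀ : ∀ s ∈ Icc (a - τ) a, N s ≤ 2 * E₀) {s : ℝ}
    (hs : s ∈ Icc a b) :
    E s ≤ (E a + M * (b - a) * E₀) * Real.exp (2 * M * (b - a)) := by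
  have hE₀ : 0 ≤ E₀ := by
    have h1 := hNE₀ a ⟨by linarith, le_rfl⟩
    have h2 := hN a ⟨by linarith, hab⟩
    linarith
  have hE0 : ∀ s ∈ Icc a b, 0 ≤ E s := fun s hs => by
    have h1 := hNE s hs
    have h2 := hN s ⟨by linarith [hs.1], hs.2⟩
    linarith
  have hNi : ∀ x ∈ Icc (a - τ) b, ∀ y ∈ Icc (a - τ) b, IntervalIntegrable N volume x y :=
    fun x hx y hy => (hNc.mono (uIcc_subset_Icc hx hy)).intervalIntegrable
  -- After the shift the domain is `[a-τ, t-τ]`: the part before `a` has length at most `t - a` and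
  -- sees only `E₀`; the part after `a` lies inside `[a,t]`.
  have hdelay : ∀ t ∈ Icc a b, ∫ r in a..t, N (r - τ) ≤ (t - a) * (2 * E₀) +
      ∫ r in a..t, N r := by
    intro t ht
    rw [intervalIntegral.integral_comp_sub_right N τ]
    have hmem : ∀ x, a - τ ≤ x → x ≤ t → x ∈ Icc (a - τ) b := fun x h1 h2 => ⟨h1, h2.trans ht.2⟩
    have hnn : ∀ x, a ≤ x → x ≤ t → 0 ≤ ∫ r in a..x, N r := fun x hx hxt =>
      intervalIntegral.integral_nonneg hx fun r hr =>
        hN r ⟨by linarith [hr.1], by linarith [hr.2, ht.2]⟩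
    have hhead : ∀ x, a - τ ≤ x → x ≤ a → ∫ r in (a - τ)..x, N r ≤ (x - (a - τ)) * (2 * E₀) := by
      intro x hx hxa
      have h1 : ∫ r in (a - τ)..x, N r ≤ ∫ r in (a - τ)..x, 2 * E₀ :=
        intervalIntegral.integral_mono_on hx
          (hNi _ (hmem _ le_rfl (by linarith [ht.1])) _ (hmem _ hx (by linarith [ht.1])))
          intervalIntegrable_const fun r hr => hNE₀ r ⟨hr.1, hr.2.trans hxa⟩
      rwa [intervalIntegral.integral_const, smul_eq_mul] at h1
    rcases le_total (t - τ) a with hle | hle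
    · have h1 := hhead (t - τ) (by linarith [ht.1]) hle
      have h2 := hnn t ht.1 le_rfl
      have : t - τ - (a - τ) = t - a := by ring
      rw [this] at h1
      linarith
    · have h1 := hhead a (by linarith) le_rfl
      have h2 : ∫ r in a..(t - τ), N r ≤ ∫ r in a..t, N r := by
        rw [← intervalIntegral.integral_add_adjacent_intervals
          (hNi a (hmem _ (by linarith) ht.1) (t - τ) (hmem _ (by linarith) (by linarith)))
          (hNi (t - τ) (hmem _ (by linarith) (by linarith)) t (hmem _ (by linarith) le_rfl))]
        have : 0 ≤ ∫ r in (t - τ)..t, N r := intervalIntegral.integral_nonneg (by linarith)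
          fun r hr => hN r ⟨by linarith [hr.1], by linarith [hr.2, ht.2]⟩
        linarith
      rw [← intervalIntegral.integral_add_adjacent_intervals
          (hNi (a - τ) (hmem _ le_rfl (by linarith)) a (hmem _ (by linarith) ht.1))
          (hNi a (hmem _ (by linarith) ht.1) (t - τ) (hmem _ (by linarith) (by linarith)))]
      have h3 : (a - (a - τ)) * (2 * E₀) ≤ (t - a) * (2 * E₀) := by
        have : a - (a - τ) ≤ t - a := by linarith
        gcongr
      linarith
  have hsub : ContinuousOn (fun r => N (r - τ)) (Icc a b) :=
    hNc.comp (by fun_prop) fun r hr => ⟨by linarith [hr.1], by linarith [hr.2]⟩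
  have hNab : ContinuousOn N (Icc a b) := hNc.mono (Icc_subset_Icc_left (by linarith))
  have hint : ∀ t ∈ Icc a b, E t ≤ E a + M * (b - a) * E₀ + 2 * M * ∫ r in a..t, E r := by
    intro t ht
    have hsubt : Icc a t ⊆ Icc a b := Icc_subset_Icc_right ht.2
    have hii : ∀ {p : ℝ → ℝ}, ContinuousOn p (Icc a b) → IntervalIntegrable p volume a t :=
      fun hp => (hp.mono (by rw [uIcc_of_le ht.1]; exact hsubt)).intervalIntegrable
    have h1 : E t - E a ≤ ∫ r in a..t, M / 2 * (N (r - τ) + N r) :=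
      intervalIntegral.sub_le_integral_of_hasDeriv_right_of_le ht.1 (hEc.mono hsubt)
        (fun r hr => (hE r ⟨hr.1, hr.2.trans_le ht.2⟩).hasDerivWithinAt)
        ((continuousOn_const.mul ((hsub.add hNab).mono hsubt)).integrableOn_Icc)
        (fun r hr => hE' r ⟨hr.1, hr.2.trans_le ht.2⟩)
    rw [intervalIntegral.integral_const_mul, intervalIntegral.integral_add (hii hsub) (hii hNab)]
      at h1
    have h2 := hdelay t ht
    have h3 : ∫ r in a..t, N r ≤ 2 * ∫ r in a..t, E r := by
      rw [← intervalIntegral.integral_const_mul]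
      exact intervalIntegral.integral_mono_on ht.1 (hii hNab) ((hii hEc).const_mul 2)
        fun r hr => hNE r (hsubt hr)
    have h4 : M / 2 * ((∫ r in a..t, N (r - τ)) + ∫ r in a..t, N r) ≤
        M / 2 * ((t - a) * (2 * E₀) + 2 * (2 * ∫ r in a..t, E r)) := by
      refine mul_le_mul_of_nonneg_left ?_ (by positivity)
      linarith
    have h5 : M * (t - a) * E₀ ≤ M * (b - a) * E₀ := by
      gcongr
      exact ht.2
    linarith
  set c := E a + M * (b - a) * E₀ with hc
  -- Gronwall with the integrating factor `exp(-2 M t)`.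
  have hanti : AntitoneOn
      (fun t => (c + 2 * M * ∫ r in a..t, E r) * Real.exp (-(2 * M) * t)) (Icc a b) := by
    refine antitoneOn_Icc_of_hasDerivAt_nonpos (p' := fun t =>
      2 * M * E t * Real.exp (-(2 * M) * t) + (c + 2 * M * ∫ r in a..t, E r) *
        (Real.exp (-(2 * M) * t) * -(2 * M))) ?_ ?_ ?_
    · refine ContinuousOn.mul (continuousOn_const.add (continuousOn_const.mul ?_)) (by fun_prop)
      have := intervalIntegral.continuousOn_primitive_interval' (μ := volume) (f := E) (a := a)
        (b₁ := a) (b₂ := b) (by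
          refine ContinuousOn.intervalIntegrable ?_
          rwa [uIcc_of_le hab]) left_mem_uIcc
      rwa [uIcc_of_le hab] at this
    · intro t ht
      have h1 : HasDerivAt (fun t => ∫ r in a..t, E r) (E t) t :=
        hasDerivAt_integral_of_continuousOn_Ioo (by
          refine (hEc.mono ?_).intervalIntegrable
          rw [uIcc_of_le ht.1.le]
          exact Icc_subset_Icc_right ht.2.le) (hEc.mono Ioo_subset_Icc_self) ht
      have h2 : HasDerivAt (fun t => Real.exp (-(2 * M) * t))
          (Real.exp (-(2 * M) * t) * -(2 * M)) t := by
        simpa using ((hasDerivAt_id t).const_mul (-(2 * M))).exp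
      exact ((h1.const_mul (2 * M)).const_add c).mul h2
    · intro t ht
      have h1 := hint t (Ioo_subset_Icc_self ht)
      have h2 := Real.exp_pos (-(2 * M) * t)
      have h3 : 2 * M * E t * Real.exp (-(2 * M) * t) ≤
          2 * M * (c + 2 * M * ∫ r in a..t, E r) * Real.exp (-(2 * M) * t) := by gcongr
      linarith
  have h1 := hanti (left_mem_Icc.mpr hab) hs hs.1
  simp only [intervalIntegral.integral_same, mul_zero, add_zero] at h1
  have hc0 : 0 ≤ c := by
    have := hE0 a (left_mem_Icc.mpr hab)
    have : 0 ≤ b - a := by linarith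
    positivity
  have h2 : c + 2 * M * ∫ r in a..s, E r ≤ c * Real.exp (2 * M * (s - a)) := by
    have h3 := mul_le_mul_of_nonneg_right h1 (Real.exp_pos (2 * M * s)).le
    rw [mul_assoc _ (Real.exp _), mul_assoc c, ← Real.exp_add, ← Real.exp_add] at h3
    have e1 : -(2 * M) * s + 2 * M * s = 0 := by ring
    have e2 : -(2 * M) * a + 2 * M * s = 2 * M * (s - a) := by ring
    rwa [e1, e2, Real.exp_zero, mul_one] at h3
  calc E s ≤ c + 2 * M * ∫ r in a..s, E r := hint s hs
    _ ≤ c * Real.exp (2 * M * (s - a)) := h2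
    _ ≤ c * Real.exp (2 * M * (b - a)) := by gcongr; exact hs.2

end RealInequalities

/-! ### Energy estimates on the two kinds of intervals -/

section Energy

variable {H : Type*} [NormedAddCommGroup H] [InnerProductSpace ℝ H] [CompleteSpace H]
  {𝒜 : CoerciveOperator H} {f : 𝒜.V → H} {F : 𝒜.V → ℝ} {u₀ : 𝒜.V} {u₁ : H}
  {v : ℝ → 𝒜.V} {z g : ℝ → H} {a b s : ℝ}

theorem norm_sq_le_two_mul_energyS (hF : IsPotential F f)
    (hsign₁ : ∀ x : 𝒜.V, inner ℝ (f x) (incl 𝒜 x) ≤ 0) (x : 𝒜.V) (y : H) :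
    ‖y‖ ^ 2 ≤ 2 * energyS F x y := by
  have h1 : F x ≤ 0 := potential_nonpos (j := incl 𝒜) hF.1 hF.2 hsign₁ x
  rw [energyS]
  nlinarith [sq_nonneg ‖x‖]

theorem IsRegularWave.continuousOn_energyS (hw : IsRegularWave (incl 𝒜) u₀ u₁ v z g)
    (hF : IsPotential F f) : ContinuousOn (fun s => energyS F (v s) (z s)) (Ici 0) := by
  have hFc : Continuous F := continuous_iff_continuousAt.mpr fun x => (hF.2 x).continuousAt
  exact (continuousOn_const.mul ((hw.cont_v.norm.pow 2).add (hw.cont_z.norm.pow 2))).sub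
    (hFc.comp_continuousOn hw.cont_v)

/-- The work of `f` is exactly the derivative of the potential, so only the feedback part of the
forcing remains. -/
theorem IsRegularWave.hasDerivAt_energyS (hw : IsRegularWave (incl 𝒜) u₀ u₁ v z g)
    (hf : Continuous f) (hF : IsPotential F f) (ha : 0 ≤ a) (hg : ContinuousOn g (Ioo a b))
    (hs : s ∈ Ioo a b) :
    HasDerivAt (fun r => energyS F (v r) (z r)) (inner ℝ (g s - f (v s)) (z s)) s := by
  have h1 := ((hw.hasDerivAt_norm_sq ha hg hs).const_mul (1 / 2)).sub
    (hw.hasDerivAt_potential hf hF.2 (ha.trans_lt hs.1))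
  refine h1.congr_deriv ?_
  rw [inner_sub_left]
  ring

variable {U₁ U₂ : Type*} [NormedAddCommGroup U₁] [InnerProductSpace ℝ U₁] [CompleteSpace U₁]
  [NormedAddCommGroup U₂] [InnerProductSpace ℝ U₂] [CompleteSpace U₂]
  {B₁ : ℝ → U₁ →L[ℝ] H} {B₂ : ℝ → U₂ →L[ℝ] H} {τ lam m M : ℝ}

/-- The pointwise estimate behind the observability inequality. -/
theorem multiplier_estimate {y d φ φ' T X X' W Z p q e : ℝ} (hlam : 0 < lam) (hm : 0 < m)
    (hM : 0 < M) (hφ : 0 ≤ φ) (hφ' : φ' ^ 2 ≤ 4 * T ^ 2 * φ) (hX : |X| ≤ Z * y)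
    (hyW : lam * y ^ 2 ≤ W ^ 2) (hZd : m * Z ^ 2 ≤ d ^ 2)
    (hp : |p| ≤ d * q) (hq : q ^ 2 ≤ M * y ^ 2)
    (hX' : X' + e ≤ 3 / 2 * Z ^ 2 - 1 / 2 * W ^ 2 - p) :
    φ' * X + φ * (X' + e) ≤ (4 * T ^ 2 / (lam * m) + φ * (3 / (2 * m) + M / lam)) * d ^ 2 := by
  have hZ2 : Z ^ 2 ≤ d ^ 2 / m := by rw [le_div_iff₀ hm]; linarith
  -- Two uses of Young's inequality, here and in `h2`, each cost `λ/4 · φ y²` once weighted;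
  -- together they exhaust `φ W² / 2 ≥ λ/2 · φ y²`.
  have h1 : φ' * X ≤ 4 * T ^ 2 / lam * Z ^ 2 + lam / 4 * φ * y ^ 2 := by
    have e1 : φ' * X ≤ |φ'| * (Z * y) := (le_abs_self _).trans (by rw [abs_mul]; gcongr)
    have e2 : |φ'| ≤ 2 * |T| * √φ := by
      rw [← abs_of_nonneg (by positivity : (0 : ℝ) ≤ 2 * |T| * √φ), ← sq_le_sq, mul_pow, mul_pow,
        sq_abs, Real.sq_sqrt hφ]
      linarith
    have e3 : |φ'| * (Z * y) ≤ 2 * |T| * √φ * (Z * y) :=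
      mul_le_mul_of_nonneg_right e2 ((abs_nonneg _).trans hX)
    have e4 : 2 * |T| * √φ * (Z * y) ≤ 4 * T ^ 2 / lam * Z ^ 2 + lam / 4 * φ * y ^ 2 := by
      have h := sq_nonneg (4 * |T| * Z - lam * √φ * y)
      have h' : 0 ≤ (16 * T ^ 2 * Z ^ 2 + lam ^ 2 * φ * y ^ 2 - 8 * |T| * Z * lam * √φ * y) := by
        calc 0 ≤ _ := h
          _ = 16 * |T| ^ 2 * Z ^ 2 + lam ^ 2 * √φ ^ 2 * y ^ 2 - 8 * |T| * Z * lam * √φ * y := by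
              ring
          _ = _ := by rw [sq_abs, Real.sq_sqrt hφ]
      have e5 : 4 * T ^ 2 / lam * Z ^ 2 + lam / 4 * φ * y ^ 2 - 2 * |T| * √φ * (Z * y) =
          (16 * T ^ 2 * Z ^ 2 + lam ^ 2 * φ * y ^ 2 - 8 * |T| * Z * lam * √φ * y) / (4 * lam) := by
        field_simp
        ring
      have : 0 ≤ (16 * T ^ 2 * Z ^ 2 + lam ^ 2 * φ * y ^ 2 - 8 * |T| * Z * lam * √φ * y) /
        (4 * lam) := by positivity
      linarith
    linarith
  have h2 : -p ≤ M / lam * d ^ 2 + lam / 4 * y ^ 2 := by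
    have e1 : -p ≤ d * q := (neg_le_abs p).trans hp
    have e2 : d * q ≤ M / lam * d ^ 2 + lam / (4 * M) * q ^ 2 := by
      have e3 : M / lam * d ^ 2 + lam / (4 * M) * q ^ 2 - d * q =
          (2 * M * d - lam * q) ^ 2 / (4 * M * lam) := by
        field_simp
        ring
      have : 0 ≤ (2 * M * d - lam * q) ^ 2 / (4 * M * lam) := by positivity
      linarith
    have e4 : lam / (4 * M) * q ^ 2 ≤ lam / (4 * M) * (M * y ^ 2) := by gcongr
    have e5 : lam / (4 * M) * (M * y ^ 2) = lam / 4 * y ^ 2 := by field_simp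
    linarith
  have h3 : φ * (X' + e) ≤ φ * (3 / 2 * (d ^ 2 / m) - lam / 4 * y ^ 2 + M / lam * d ^ 2) := by
    refine mul_le_mul_of_nonneg_left ?_ hφ
    linarith
  have h4 : 4 * T ^ 2 / lam * Z ^ 2 ≤ 4 * T ^ 2 / lam * (d ^ 2 / m) := by gcongr
  calc φ' * X + φ * (X' + e) ≤ 4 * T ^ 2 / lam * (d ^ 2 / m) + lam / 4 * φ * y ^ 2 +
        φ * (3 / 2 * (d ^ 2 / m) - lam / 4 * y ^ 2 + M / lam * d ^ 2) := by linarith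
    _ = _ := by field_simp; ring

/-- On an interval with instantaneous damping and without delay the energy decreases, by a fixed
factor between the end points. -/
theorem energy_decay (hw : IsRegularWave (incl 𝒜) u₀ u₁ v z (forcing f B₁ B₂ τ v z))
    (hlam : 0 < lam) (hembed : ∀ x : 𝒜.V, lam * ‖incl 𝒜 x‖ ^ 2 ≤ ‖x‖ ^ 2)
    (hf : Continuous f) (hF : IsPotential F f)
    (hsign₂ : ∀ x : 𝒜.V, inner ℝ (f x) (incl 𝒜 x) - F x ≤ 0)
    (ha : 0 ≤ a) (hab : a < b) (hB₂ : ∀ s ∈ Ico a b, B₂ s = 0) (hB₁ : IsC1UpTo B₁ a b)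
    (hm : 0 < m) (hM : 0 < M)
    (hB : ∀ s ∈ Ico a b, ∀ x : H, m * ‖x‖ ^ 2 ≤ ‖(B₁ s).adjoint x‖ ^ 2 ∧
      ‖(B₁ s).adjoint x‖ ^ 2 ≤ M * ‖x‖ ^ 2) :
    AntitoneOn (fun s => energyS F (v s) (z s)) (Icc a b) ∧
      energyS F (v b) (z b) ≤ 1 / (1 + (b - a) ^ 3 / 30 * (1 / (4 / (lam * m) +
        3 * (b - a) ^ 2 / (32 * m) + M * (b - a) ^ 2 / (16 * lam)))) * energyS F (v a) (z a) := by
  have hsub : Icc a b ⊆ Ici 0 := fun r hr => ha.trans hr.1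
  have hval : ∀ s ∈ Ioo a b,
      forcing f B₁ B₂ τ v z s = f (v s) - B₁ s ((B₁ s).adjoint (z s)) := by
    intro s hs
    rw [forcing, hB₂ s (Ioo_subset_Ico_self hs)]
    simp
  have hvc := hw.cont_v.mono (Ioo_subset_Icc_self.trans hsub)
  have hzc := hw.cont_z.mono (Ioo_subset_Icc_self.trans hsub)
  have hg : ContinuousOn (forcing f B₁ B₂ τ v z) (Ioo a b) :=
    ((hf.comp_continuousOn hvc).sub (hB₁.continuousOn_feedback hzc)).congr hval
  have hE : ∀ s ∈ Ioo a b, HasDerivAt (fun r => energyS F (v r) (z r))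
      (-‖(B₁ s).adjoint (z s)‖ ^ 2) s := by
    intro s hs
    refine (hw.hasDerivAt_energyS hf hF ha hg hs).congr_deriv ?_
    rw [hval s hs, sub_sub_cancel_left, inner_neg_left,
      ← ContinuousLinearMap.adjoint_inner_right, real_inner_self_eq_norm_sq]
  have hEc := (hw.continuousOn_energyS hF).mono hsub
  refine ⟨antitoneOn_Icc_of_hasDerivAt_nonpos hEc hE fun s _ => by simp, ?_⟩
  refine multiplier_decay (E := fun s => energyS F (v s) (z s)) hab hlam hm hM hEc
    ((hw.cont_z.mono hsub).inner ((incl 𝒜).continuous.comp_continuousOn (hw.cont_v.mono hsub)))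
    hE (fun s hs => hw.hasDerivAt_inner ha hg hs) (fun s _ => sq_nonneg _) ?_
  intro s hs φ φ' hφ hφ'
  have hBs := hB s (Ioo_subset_Ico_self hs)
  refine multiplier_estimate (y := ‖incl 𝒜 (v s)‖) (W := ‖v s‖) (Z := ‖z s‖)
    (p := inner ℝ ((B₁ s).adjoint (z s)) ((B₁ s).adjoint (incl 𝒜 (v s))))
    (q := ‖(B₁ s).adjoint (incl 𝒜 (v s))‖) hlam hm hM hφ hφ' (abs_real_inner_le_norm _ _)
    (hembed _) (hBs _).1 (abs_real_inner_le_norm _ _) (hBs _).2 ?_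
  -- In the sum of the multiplier's derivative and the energy, the nonlinear terms are exactly
  -- `⟨f(v), v⟩ - F(v)`.
  have h1 := hsign₂ (v s)
  rw [hval s hs, inner_sub_left, ContinuousLinearMap.adjoint_inner_right, energyS]
  linarith

/-- On an interval with delayed feedback and without damping the growth of the energy is
controlled. -/
theorem energy_growth (hw : IsRegularWave (incl 𝒜) u₀ u₁ v z (forcing f B₁ B₂ τ v z))
    (hf : Continuous f) (hF : IsPotential F f)
    (hsign₁ : ∀ x : 𝒜.V, inner ℝ (f x) (incl 𝒜 x) ≤ 0)
    (hτ : 0 < τ) (ha : 0 ≤ a - τ) (hab : a ≤ b) (hB₁ : ∀ s ∈ Ico a b, B₁ s = 0)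
    (hB₂ : IsC1UpTo B₂ a b) (hM : 0 < M)
    (hB : ∀ s ∈ Ico a b, ∀ x : H, ‖(B₂ s).adjoint x‖ ^ 2 ≤ M * ‖x‖ ^ 2) {E₀ : ℝ}
    (hE₀ : ∀ s ∈ Icc (a - τ) a, energyS F (v s) (z s) ≤ E₀) (hs : s ∈ Icc a b) :
    energyS F (v s) (z s) ≤
      (energyS F (v a) (z a) + M * (b - a) * E₀) * Real.exp (2 * M * (b - a)) := by
  have hpos : ∀ x y, ‖y‖ ^ 2 ≤ 2 * energyS F x y := norm_sq_le_two_mul_energyS hF hsign₁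
  have ha0 : 0 ≤ a := by linarith
  have hsub : Icc a b ⊆ Ici 0 := fun r hr => ha0.trans hr.1
  have hval : ∀ s ∈ Ioo a b,
      forcing f B₁ B₂ τ v z s = f (v s) - B₂ s ((B₂ s).adjoint (z (s - τ))) := by
    intro s hs
    rw [forcing, hB₁ s (Ioo_subset_Ico_self hs)]
    simp
  have hvc := hw.cont_v.mono (Ioo_subset_Icc_self.trans hsub)
  have hzc : ContinuousOn (fun s => z (s - τ)) (Ioo a b) :=
    hw.cont_z.comp (by fun_prop) fun r hr => by
      simp only [mem_Ici]
      linarith [hr.1]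
  have hg : ContinuousOn (forcing f B₁ B₂ τ v z) (Ioo a b) :=
    ((hf.comp_continuousOn hvc).sub (hB₂.continuousOn_feedback hzc)).congr hval
  refine delayed_growth (E := fun s => energyS F (v s) (z s)) (N := fun s => ‖z s‖ ^ 2) hab hτ
    hM.le ((hw.continuousOn_energyS hF).mono hsub)
    ((hw.cont_z.mono fun r hr => ha.trans hr.1).norm.pow 2)
    (fun s hs => hw.hasDerivAt_energyS hf hF ha0 hg hs) ?_ (fun s _ => sq_nonneg _)
    (fun s _ => hpos _ _) (fun s hs => (hpos _ _).trans (by linarith [hE₀ s hs])) hs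
  intro s hs
  have h1 := hB s (Ioo_subset_Ico_self hs) (z s)
  have h2 := hB s (Ioo_subset_Ico_self hs) (z (s - τ))
  rw [hval s hs, sub_sub_cancel_left, inner_neg_left, ← ContinuousLinearMap.adjoint_inner_right]
  have h3 := neg_le_abs
    (inner ℝ ((B₂ s).adjoint (z (s - τ))) ((B₂ s).adjoint (z s)))
  have h4 := abs_real_inner_le_norm ((B₂ s).adjoint (z (s - τ))) ((B₂ s).adjoint (z s))
  have h5 := sq_nonneg (‖(B₂ s).adjoint (z (s - τ))‖ - ‖(B₂ s).adjoint (z s)‖)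
  linarith

end Energy

/-! ### Combining the intervals -/

theorem cTilde_pos {lam : ℝ} {m M : ℕ → ℝ} {t : ℕ → ℝ} {n : ℕ} (hlam : 0 < lam)
    (ht : StrictMono t) (hm : 0 < m (2 * n)) (hM : 0 < M (2 * n))
    (hM' : 0 < M (2 * n + 1)) : 0 < cTilde lam m M t n := by
  have h1 : 0 < len t (2 * n) := sub_pos.mpr (ht (Nat.lt_succ_self _))
  have h2 : 0 < len t (2 * n + 1) := sub_pos.mpr (ht (Nat.lt_succ_self _))
  unfold cTilde
  positivity

/-- An energy that is controlled on each pair of consecutive intervals by factors whose partial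
products tend to zero tends to zero. -/
theorem tendsto_zero_of_interval_bounds {E : ℝ → ℝ} {t : ℕ → ℝ} {β : ℕ → ℝ} (ht0 : t 0 = 0)
    (htop : Tendsto t atTop atTop) (hpos : ∀ s, 0 ≤ E s)
    (heven : ∀ n, ∀ s ∈ Icc (t (2 * n)) (t (2 * n + 1)), E s ≤ E (t (2 * n)))
    (hodd : ∀ n, ∀ s ∈ Icc (t (2 * n + 1)) (t (2 * n + 2)), E s ≤ Real.exp (β n) * E (t (2 * n)))
    (hle : ∀ n, t n ≤ t (n + 1))
    (hdiv : Tendsto (fun N => ∑ n ∈ Finset.range N, β n) atTop atBot) :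
    Tendsto E atTop (𝓝 0) := by
  set S : ℕ → ℝ := fun N => ∑ n ∈ Finset.range N, β n with hS
  have hmono : Monotone t := monotone_nat_of_le_succ hle
  have hE0 := hpos 0
  have hstep : ∀ n, E (t (2 * n)) ≤ Real.exp (S n) * E 0 := by
    intro n
    induction n with
    | zero => simp [hS, ht0]
    | succ k ih =>
      have h1 := hodd k (t (2 * (k + 1))) ⟨hle _, le_rfl⟩
      calc E (t (2 * (k + 1))) ≤ Real.exp (β k) * E (t (2 * k)) := h1
        _ ≤ Real.exp (β k) * (Real.exp (S k) * E 0) := by gcongr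
        _ = Real.exp (S (k + 1)) * E 0 := by
          simp only [hS]
          rw [Finset.sum_range_succ, Real.exp_add]
          ring
  have hlim : Tendsto (fun n => Real.exp (S n) * E 0) atTop (𝓝 0) := by
    simpa using (Real.tendsto_exp_atBot.comp hdiv).mul_const (E 0)
  rw [Metric.tendsto_atTop]
  intro ε hε
  obtain ⟨N, hN⟩ := Metric.tendsto_atTop.mp hlim ε hε
  have hsmall : ∀ n, N ≤ n → Real.exp (S n) * E 0 < ε := fun n hn => by
    have := hN n hn
    rw [Real.dist_eq, sub_zero] at this
    exact (le_abs_self _).trans_lt this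
  refine ⟨t (2 * N), fun s hs => ?_⟩
  rw [Real.dist_eq, sub_zero, abs_of_nonneg (hpos s)]
  obtain ⟨k, hk⟩ := (htop.eventually (eventually_gt_atTop s)).exists
  -- The least such index singles out the pair of intervals containing `s`; it is at least `N`
  -- because `s ≥ t (2N)`.
  have hex : ∃ n, s < t (2 * (n + 1)) := ⟨k, hk.trans_le (hmono (by omega))⟩
  classical
  set n := Nat.find hex with hn
  have h1 : s < t (2 * (n + 1)) := Nat.find_spec hex
  have hNn : N ≤ n := by
    by_contra hlt
    push Not at hlt
    exact absurd (h1.trans_le (hmono (by omega : 2 * (n + 1) ≤ 2 * N))) (not_lt.mpr hs)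
  have h2 : t (2 * n) ≤ s := by
    rcases Nat.eq_zero_or_pos n with h0 | h0
    · rw [h0]
      exact (hmono (by omega)).trans hs
    · have := Nat.find_min hex (m := n - 1) (by omega)
      push Not at this
      rwa [show 2 * (n - 1 + 1) = 2 * n by omega] at this
  rcases le_total s (t (2 * n + 1)) with h3 | h3
  · exact ((heven n s ⟨h2, h3⟩).trans (hstep n)).trans_lt (hsmall n hNn)
  · refine lt_of_le_of_lt ?_ (hsmall (n + 1) (by omega))
    calc E s ≤ Real.exp (β n) * E (t (2 * n)) := hodd n s ⟨h3, h1.le⟩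
      _ ≤ Real.exp (β n) * (Real.exp (S n) * E 0) := by gcongr; exact hstep n
      _ = Real.exp (S (n + 1)) * E 0 := by
        simp only [hS]
        rw [Finset.sum_range_succ, Real.exp_add]
        ring

end DelayWave
end

open DelayWave in
theorem theorem3p2
    {H U₂ : Type*}
    [NormedAddCommGroup H] [InnerProductSpace ℝ H] [CompleteSpace H]
    [NormedAddCommGroup U₂] [InnerProductSpace ℝ U₂] [CompleteSpace U₂]
    (𝒜 : CoerciveOperator H)
    -- the constant of the embedding of `V` into `H`
    (lam : ℝ) (hlam : 0 < lam) (hembed : ∀ v : 𝒜.V, lam * ‖incl 𝒜 v‖ ^ 2 ≤ ‖v‖ ^ 2)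
    -- the nonlinearity, its potential and the two sign conditions
    (f : 𝒜.V → H) (F : 𝒜.V → ℝ) (hf : LocLipschitz f) (hF : IsPotential F f)
    (hsign₁ : ∀ v : 𝒜.V, inner ℝ (f v) (incl 𝒜 v) ≤ 0)
    (hsign₂ : ∀ v : 𝒜.V, inner ℝ (f v) (incl 𝒜 v) - F v ≤ 0)
    -- the delay and the intervals
    (τ : ℝ) (hτ : 0 < τ)
    (t : ℕ → ℝ) (ht0 : t 0 = 0) (ht : StrictMono t) (hτT : ∀ n, τ ≤ len t (2 * n))
    -- the feedback operators
    (B₁ : ℝ → H →L[ℝ] H) (B₂ : ℝ → U₂ →L[ℝ] H)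
    (hB₂zero : ∀ n, ∀ s ∈ Set.Ico (t (2 * n)) (t (2 * n + 1)), B₂ s = 0)
    (hB₁zero : ∀ n, ∀ s ∈ Set.Ico (t (2 * n + 1)) (t (2 * n + 2)), B₁ s = 0)
    (hB₁C1 : ∀ n, IsC1UpTo B₁ (t (2 * n)) (t (2 * n + 1)))
    (hB₂C1 : ∀ n, IsC1UpTo B₂ (t (2 * n + 1)) (t (2 * n + 2)))
    (m M : ℕ → ℝ) (hm : ∀ n, 0 < m (2 * n)) (hmM : ∀ n, m (2 * n) ≤ M (2 * n))
    (hM : ∀ n, 0 < M (2 * n + 1))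
    (h_i : ∀ n, ∀ s ∈ Set.Ico (t (2 * n)) (t (2 * n + 1)), ∀ x : H,
      m (2 * n) * ‖x‖ ^ 2 ≤ ‖(B₁ s).adjoint x‖ ^ 2 ∧
        ‖(B₁ s).adjoint x‖ ^ 2 ≤ M (2 * n) * ‖x‖ ^ 2)
    (h_ii : ∀ n, ∀ s ∈ Set.Ico (t (2 * n + 1)) (t (2 * n + 2)), ∀ x : H,
      ‖(B₂ s).adjoint x‖ ^ 2 ≤ M (2 * n + 1) * ‖x‖ ^ 2)
    -- the divergence condition
    (hdiv : Filter.Tendsto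
      (fun N : ℕ => ∑ n ∈ Finset.range N,
        (2 * M (2 * n + 1) * len t (2 * n + 1) + Real.log (cTilde lam m M t n)))
      Filter.atTop Filter.atBot)
    -- an arbitrary solution
    (u₀ : 𝒜.V) (u₁ : H) (u : ℝ → 𝒜.V) (ut : ℝ → H)
    (hu : IsSolution 𝒜 f B₁ B₂ τ u₀ u₁ u ut) :
    ∃ (v : ℝ → 𝒜.V) (w : ℝ → H),
      -- the representative of `u` in `C([0,∞);V) ∩ C¹([0,∞);H)` and its derivative
      ContinuousOn v (Set.Ici 0) ∧ ContinuousOn w (Set.Ici 0) ∧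
      (∀ s, 0 ≤ s → HasDerivWithinAt (fun r => incl 𝒜 (v r)) (w s) (Set.Ici 0) s) ∧
      (∀ᵐ s ∂MeasureTheory.volume.restrict (Set.Ioi (0 : ℝ)), u s = v s ∧ ut s = w s) ∧
      -- the standard energy tends to zero
      Filter.Tendsto (fun s => energyS F (v s) (w s)) Filter.atTop (nhds 0) := by
  have hlt : ∀ n, t n < t (n + 1) := fun n => ht (Nat.lt_succ_self n)
  have hpos : ∀ n, 0 ≤ t n := fun n => ht0 ▸ ht.monotone (Nat.zero_le n)
  have hM₀ : ∀ n, 0 < M (2 * n) := fun n => (hm n).trans_le (hmM n)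
  have hfc := hf.continuous
  have hC1₁ : ∀ n, IsC1UpTo B₁ (t n) (t (n + 1)) := by
    intro n
    rcases Nat.even_or_odd' n with ⟨k, rfl | rfl⟩
    · exact hB₁C1 k
    · exact isC1UpTo_of_eq_zero (hB₁zero k)
  have hC1₂ : ∀ n, IsC1UpTo B₂ (t n) (t (n + 1)) := by
    intro n
    rcases Nat.even_or_odd' n with ⟨k, rfl | rfl⟩
    · exact isC1UpTo_of_eq_zero (hB₂zero k)
    · exact hB₂C1 k
  obtain ⟨v, w, hae, hw⟩ := hu.exists_regular hτ ht0 ht hτT hB₂zero hC1₁ hC1₂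
  refine ⟨v, w, hw.cont_v, hw.cont_z, fun s hs => hw.hasDerivWithinAt_pos hs,
    (MeasureTheory.ae_restrict_iff' measurableSet_Ioi).mpr hae, ?_⟩
  have hE0 : ∀ x y, 0 ≤ energyS F x y := fun x y => by
    have := norm_sq_le_two_mul_energyS hF hsign₁ x y
    nlinarith [sq_nonneg ‖y‖]
  have hdecay := fun n => energy_decay hw hlam hembed hfc hF hsign₂ (hpos (2 * n)) (hlt _)
    (hB₂zero n) (hB₁C1 n) (hm n) (hM₀ n) (h_i n)
  have heven : ∀ n, ∀ s ∈ Set.Icc (t (2 * n)) (t (2 * n + 1)),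
      energyS F (v s) (w s) ≤ energyS F (v (t (2 * n))) (w (t (2 * n))) := fun n s hs =>
    (hdecay n).1 (Set.left_mem_Icc.mpr (hlt _).le) hs hs.1
  refine tendsto_zero_of_interval_bounds (E := fun s => energyS F (v s) (w s)) ht0
    (tendsto_times hτ ht0 ht hτT) (fun s => hE0 _ _) heven ?_ (fun n => (hlt n).le) hdiv
  intro n s hs
  -- The delay window before the odd interval lies in the preceding even one, so `E₀` can be the
  -- energy at `t (2n)`.
  have hdelay : t (2 * n) ≤ t (2 * n + 1) - τ := by
    have := hτT n
    rw [len] at this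
    linarith
  have hgrow := energy_growth hw hfc hF hsign₁ hτ ((hpos _).trans hdelay) (hlt (2 * n + 1)).le
    (hB₁zero n) (hB₂C1 n) (hM n) (h_ii n)
    (fun r hr => heven n r ⟨hdelay.trans hr.1, hr.2⟩) hs
  refine hgrow.trans ?_
  -- Positivity of `c̃_n` lets the logarithm in the divergence condition be undone; its two summands
  -- then match the decayed energy at `t (2n+1)` and the delayed contribution.
  rw [Real.exp_add, Real.exp_log (cTilde_pos hlam ht (hm n) (hM₀ n) (hM n)), mul_comm (Real.exp _),
    mul_right_comm (cTilde lam m M t n)]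
  refine mul_le_mul_of_nonneg_right ?_ (Real.exp_pos _).le
  rw [cTilde, add_mul]
  exact add_le_add (hdecay n).2 le_rfl
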